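/- **Setting.** Let $J\ge 1$, let $\overline\Omega\subseteq\mathbb R^d$ be open and $\Omega\subseteq\overline\Omega$ compact. For $\ell=1,\dots,\kappa$ let $f_\ell:\overline\Omega\to\mathbb R$ be real-analytic and let $\mathbf A_\ell$ be a compact self-adjoint operator on $\ell^2(\mathbb N)$ (complex sequences); put $\mathbf A(\omega)=\sum_{\ell=1}^{\kappa} f_\ell(\omega)\mathbf A_\ell$. Assume that $\mathbf A(\omega)$ has at least $J$ positive eigenvalues, counted with multiplicity, for every $\omega\in\Omega$. Let $\lambda_j(\omega)$ denote the $j$th largest eigenvalue of $\mathbf A(\omega)$, counted with multiplicity. For a finite-dimensional subspace $\mathcal V\subset\ell^2(\mathbb N)$ let $\lambda_J^{\mathcal V}(\omega)$ denote the $J$th largest eigenvalue of the compression of $\mathbf A(\omega)$ to $\mathcal V$ (restriction to $\mathcal V$ followed by orthogonal projection onto $\mathcal V$). **Extended greedy subspace procedure (Alg. 2).** Choose any $\omega^{(1)}\in\Omega$, and let $\mathcal S_1$ be the span of $J$ linearly independent eigenvectors corresponding to $\lambda_1(\omega^{(1)}),\dots,\lambda_J(\omega^{(1)})$. For $k=2,3,\dots$,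 with $\lambda_J^{(k-1)}:=\lambda_J^{\mathcal S_{k-1}}$: - let $\omega^{(k)}$ be any global minimizer of $\lambda_J^{(k-1)}$ over $\Omega$ (for the minimization problem; for the maximization problem, any global maximizer, the same choice of problem for all $k$); - let $h^{(k)}=\|\omega^{(k)}-\omega^{(k-1)}\|_2$, $e_{pp}=e_p$ and $e_{pq}=(e_p+e_q)/\sqrt2$ for $p\ne q$, where $e_1,\dots,e_d$ is the standard basis of $\mathbb R^d$; - let $\mathcal S_k$ be the sum of $\mathcal S_{k-1}$, of the span of $J$ linearly independent eigenvectors corresponding to $\lambda_1,\dots,\lambda_J$ at $\omega^{(k)}$, and, for all $1\le p\le q\le d$, of the span of $J$ linearly independent eigenvectors corresponding to $\lambda_1,\dots,\lambda_J$ at $\omega^{(k)}+h^{(k)}e_{pq}$. It is understood that the procedure can be carried out, that is, the points $\omega^{(k)}+h^{(k)}e_{pq}$ lie in $\overline\Omega$ and the eigenvectors there exist. **Proposition 2.9.** Suppose that a sequence $\{\omega^{(k)}\}$ generated by this procedure converges, that its limit $\omega_\ast$ lies in the interior of $\Omega$, and that $\lambda_J(\omega_\ast)$ is simple. Then there are an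 open ball $\mathcal B\subseteq\Omega$ centred at $\omega_\ast$, a constant $C$ and an index $k_0\ge1$ such that for every $k\ge k_0$ the reduced eigenvalue function $\omega\mapsto\lambda_J^{(k)}(\omega)$ is three times continuously differentiable on $\mathcal B$, and the norm of its third derivative (as a trilinear form on $\mathbb R^d$) is at most $C$ at every point of $\mathcal B$. In particular, all third partial derivatives exist on $\mathcal B$ and are bounded there by $C$. -/

import Mathlib

open Set Filter Topology

noncomputable section

/-- The Hilbert space of square summable complex sequences. -/
abbrev Ell2 : Type := lp (fun _ : ℕ => ℂ) 2

section Eigenvalues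

variable {G : Type*} [AddCommGroup G] [Module ℂ G]

/-- `T` has at least `j` real eigenvalues in the set `I`, counted with multiplicity: there are
`j` linearly independent eigenvectors whose eigenvalues belong to `I`. -/
def HasEigenvaluesIn (T : Module.End ℂ G) (j : ℕ) (I : Set ℝ) : Prop :=
  ∃ v : Fin j → G, LinearIndependent ℂ v ∧ ∀ i, ∃ ν ∈ I, T (v i) = (ν : ℂ) • v i

/-- The `j`-th largest eigenvalue (`j = 1, 2, …`), counted with multiplicity, of an operator with
real spectrum: the largest eigenvalue `μ` such that at least `j` eigenvalues are `≥ μ`.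
For a self-adjoint operator on a space of finite dimension `≥ j`, and for a compact self-adjoint
operator with at least `j` positive eigenvalues, the supremum is a maximum. -/
def nthEigenvalue (T : Module.End ℂ G) (j : ℕ) : ℝ :=
  sSup {μ : ℝ | Module.End.HasEigenvalue T (μ : ℂ) ∧ HasEigenvaluesIn T j (Ici μ)}

/-- The `j`-th largest eigenvalue is simple: its eigenspace has dimension one. -/
def IsSimpleNthEigenvalue (T : Module.End ℂ G) (j : ℕ) : Prop :=
  Module.finrank ℂ (Module.End.eigenspace T (nthEigenvalue T j : ℂ)) = 1

/-- `s 0, …, s (J - 1)` are (linearly independent) eigenvectors corresponding to the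
`J` largest eigenvalues `λ₁, …, λ_J` of `T`. -/
def AreLeadingEigenvectors {J : ℕ} (T : Module.End ℂ G) (s : Fin J → G) : Prop :=
  LinearIndependent ℂ s ∧ ∀ i : Fin J, T (s i) = (nthEigenvalue T (i + 1) : ℂ) • s i

end Eigenvalues

variable {d κ J : ℕ}

/-- The parameter dependent operator `A(ω) = ∑ ℓ, f_ℓ(ω) A_ℓ`. -/
def paramOp (f : Fin κ → EuclideanSpace ℝ (Fin d) → ℝ) (A : Fin κ → Ell2 →L[ℂ] Ell2)
    (x : EuclideanSpace ℝ (Fin d)) : Ell2 →L[ℂ] Ell2 :=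
  ∑ l, (f l x : ℂ) • A l

/-- The compression of `T` to `V`: restrict `T` to `V` and project the result orthogonally
onto `V`. In the coordinates of an orthonormal basis of `V` this is `𝐕* T 𝐕`. -/
def compression (T : Ell2 →L[ℂ] Ell2) (V : Submodule ℂ Ell2) [V.HasOrthogonalProjection] :
    V →L[ℂ] V :=
  V.orthogonalProjectionOnto ∘L T ∘L V.subtypeL

/-- `λ_j(ω)`, the `j`-th largest eigenvalue of `A(ω)`. -/
def eigFun (f : Fin κ → EuclideanSpace ℝ (Fin d) → ℝ) (A : Fin κ → Ell2 →L[ℂ] Ell2) (j : ℕ)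
    (x : EuclideanSpace ℝ (Fin d)) : ℝ :=
  nthEigenvalue (paramOp f A x : Ell2 →ₗ[ℂ] Ell2) j

/-- `λ_j^V(ω)`, the `j`-th largest eigenvalue of the compression of `A(ω)` to `V`. -/
def reducedEigFun (f : Fin κ → EuclideanSpace ℝ (Fin d) → ℝ) (A : Fin κ → Ell2 →L[ℂ] Ell2)
    (V : Submodule ℂ Ell2) [V.HasOrthogonalProjection] (j : ℕ)
    (x : EuclideanSpace ℝ (Fin d)) : ℝ :=
  nthEigenvalue (compression (paramOp f A x) V : V →ₗ[ℂ] V) j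

/-- The directions `e_pp = e_p` and `e_pq = (e_p + e_q) / √2` for `p ≠ q`. -/
def dirVec (p q : Fin d) : EuclideanSpace ℝ (Fin d) :=
  if p = q then EuclideanSpace.single p 1
  else (1 / √2 : ℝ) • (EuclideanSpace.single p 1 + EuclideanSpace.single q 1)

/-- The perturbed points `ω⁽ᵏ⁾ + h⁽ᵏ⁾ e_pq` with `h⁽ᵏ⁾ = ‖ω⁽ᵏ⁾ - ω⁽ᵏ⁻¹⁾‖₂`, for `k ≥ 2`. -/
def trialPoint (w : ℕ → EuclideanSpace ℝ (Fin d)) (k : ℕ) (p q : Fin d) :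
    EuclideanSpace ℝ (Fin d) :=
  w k + ‖w k - w (k - 1)‖ • dirVec p q

/-- The subspaces `𝒮₁ ⊆ 𝒮₂ ⊆ …` built from eigenvectors `s k i` at `ω⁽ᵏ⁾` and `t k p q i`
at `ω⁽ᵏ⁾ + h⁽ᵏ⁾ e_pq` (`p ≤ q`). The iteration starts at `k = 1`; the value at `0` is not used. -/
def greedySubspace (s : ℕ → Fin J → Ell2) (t : ℕ → Fin d → Fin d → Fin J → Ell2) :
    ℕ → Submodule ℂ Ell2
  | 0 => ⊥
  | 1 => Submodule.span ℂ (range (s 1))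
  | k + 2 => greedySubspace s t (k + 1) ⊔ Submodule.span ℂ (range (s (k + 2))) ⊔
      ⨆ (p : Fin d) (q : Fin d) (_ : p ≤ q), Submodule.span ℂ (range (t (k + 2) p q))

instance greedySubspace_finiteDimensional (s : ℕ → Fin J → Ell2)
    (t : ℕ → Fin d → Fin d → Fin J → Ell2) (k : ℕ) :
    FiniteDimensional ℂ (greedySubspace s t k) := by
  have hspan : ∀ v : Fin J → Ell2, FiniteDimensional ℂ (Submodule.span ℂ (range v)) :=
    fun v => FiniteDimensional.span_of_finite ℂ (finite_range v)
  induction k with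
  | zero => rw [greedySubspace]; infer_instance
  | succ k ih =>
    cases k with
    | zero => rw [greedySubspace]; exact hspan _
    | succ k =>
      rw [greedySubspace]
      have := hspan (s (k + 2))
      have := fun p q => hspan (t (k + 2) p q)
      infer_instance

/-- `λ_j⁽ᵏ⁾(ω)`, the reduced eigenvalue function at step `k`. -/
def stepEigFun (f : Fin κ → EuclideanSpace ℝ (Fin d) → ℝ) (A : Fin κ → Ell2 →L[ℂ] Ell2)
    (s : ℕ → Fin J → Ell2) (t : ℕ → Fin d → Fin d → Fin J → Ell2) (k j : ℕ)
    (x : EuclideanSpace ℝ (Fin d)) : ℝ :=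
  reducedEigFun f A (greedySubspace s t k) j x

/-- The sequence `w 1, w 2, …` with eigenvectors `s`, `t` is produced by the extended greedy
subspace procedure on the feasible region `Ω`, for the minimization or for the maximization of
the `J`-th largest eigenvalue. `U` is the open set on which `A(ω)` is defined. -/
structure IsExtendedGreedyRun (U Ω : Set (EuclideanSpace ℝ (Fin d)))
    (f : Fin κ → EuclideanSpace ℝ (Fin d) → ℝ) (A : Fin κ → Ell2 →L[ℂ] Ell2)
    (w : ℕ → EuclideanSpace ℝ (Fin d)) (s : ℕ → Fin J → Ell2)
    (t : ℕ → Fin d → Fin d → Fin J → Ell2) : Prop where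
  mem : ∀ k, 1 ≤ k → w k ∈ Ω
  eigenvectors : ∀ k, 1 ≤ k →
    AreLeadingEigenvectors (paramOp f A (w k) : Ell2 →ₗ[ℂ] Ell2) (s k)
  optimal :
    (∀ k, 1 ≤ k → IsMinOn (stepEigFun f A s t k J) Ω (w (k + 1))) ∨
    (∀ k, 1 ≤ k → IsMaxOn (stepEigFun f A s t k J) Ω (w (k + 1)))
  trial_mem : ∀ k, 2 ≤ k → ∀ p q : Fin d, p ≤ q → trialPoint w k p q ∈ U
  trial_eigenvectors : ∀ k, 2 ≤ k → ∀ p q : Fin d, p ≤ q →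
    AreLeadingEigenvectors (paramOp f A (trialPoint w k p q) : Ell2 →ₗ[ℂ] Ell2) (t k p q)

end

/-! The reduced functions are all obtained from one smooth function by varying a convergent
parameter. The compression of `A(ω)` to `V k` and the corner `P_k A(ω) P_k`, an operator on the
whole of `Ell2`, have the same positive eigenvalues. The subspaces increase, so `P_k` converges
strongly to the projection `P` onto the closure of their union; since each `A l` is compact, `P_k
A_l P_k` converges to `P A_l P` in norm (`tendsto_corner`).

Min-max bounds show that the `J`-th eigenvalue of these compressed operators stays in a fixed
spectral window containing no other eigenvalue. From below, one space `V k₁` already contains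
leading eigenvectors at a point near the limit; from above, compression cannot raise eigenvalues
(`AreLeadingEigenvectors.exists_isolating_subspaces`).

Hence the eigenvalue near that of the limit corner is a `C³` function `Λ` of the operator, by the
implicit function theorem (`IsCompactOperator.exists_contDiffAt_eigenvalue`). Near the limit point
and for large `k`, the reduced function is `Re Λ(∑ f_l(ω) P_k A_l P_k)`. This is a fixed `C³`
function of `ω` and of the operators `P_k A_l P_k`, and local boundedness of its third derivative
gives a bound independent of `k` (`ContDiffAt.exists_uniform_bound_iteratedFDeriv`). -/

open scoped InnerProductSpace ContDiff

/-! ### Variational bounds for quadratic forms and their perturbation -/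

section Forms

variable {G : Type*} [NormedAddCommGroup G] [InnerProductSpace ℂ G]

/-- The quadratic form of `T` is at least `c` on a subspace of dimension at least `n`. -/
def FormLowerBound (T : G →L[ℂ] G) (c : ℝ) (n : ℕ) : Prop :=
  ∃ W : Submodule ℂ G, FiniteDimensional ℂ W ∧ n ≤ Module.finrank ℂ W ∧
    ∀ x ∈ W, c * ‖x‖ ^ 2 ≤ T.reApplyInnerSelf x

/-- The quadratic form of `T` is at most `c` on the complement of a subspace of dimension less
than `n`. -/
def FormUpperBound (T : G →L[ℂ] G) (c : ℝ) (n : ℕ) : Prop :=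
  ∃ W : Submodule ℂ G, FiniteDimensional ℂ W ∧ Module.finrank ℂ W < n ∧
    ∀ x ∈ Wᗮ, T.reApplyInnerSelf x ≤ c * ‖x‖ ^ 2

/-- A subspace of dimension at least `n` meets the orthogonal complement of one of dimension less
than `n` in a nonzero vector, where both bounds apply. -/
theorem FormLowerBound.le_of_upperBound {T : G →L[ℂ] G} {c c' : ℝ} {n : ℕ}
    (h : FormLowerBound T c n) (h' : FormUpperBound T c' n) : c ≤ c' := by
  obtain ⟨W, hW, hn, hc⟩ := h
  obtain ⟨W', hW', hn', hc'⟩ := h'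
  have hker : LinearMap.ker (W'.orthogonalProjectionOnto.toLinearMap ∘ₗ W.subtype) ≠ ⊥ :=
    LinearMap.ker_ne_bot_of_finrank_lt (by omega)
  obtain ⟨⟨x, hxW⟩, hx, hx0⟩ := Submodule.exists_mem_ne_zero_of_ne_bot hker
  have hx' : x ∈ W'ᗮ := by
    simpa [Submodule.orthogonalProjectionOnto_eq_zero_iff] using hx
  have hpos : 0 < ‖x‖ ^ 2 := by
    have : x ≠ 0 := fun h0 => hx0 (by simpa using h0)
    positivity
  exact le_of_mul_le_mul_right ((hc x hxW).trans (hc' x hx')) hpos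

theorem abs_reApplyInnerSelf_sub_le (T S : G →L[ℂ] G) (x : G) :
    |T.reApplyInnerSelf x - S.reApplyInnerSelf x| ≤ ‖T - S‖ * ‖x‖ ^ 2 := by
  have h : T.reApplyInnerSelf x - S.reApplyInnerSelf x = RCLike.re ⟪(T - S) x, x⟫_ℂ := by
    simp [ContinuousLinearMap.reApplyInnerSelf_apply]
  rw [h]
  calc |RCLike.re ⟪(T - S) x, x⟫_ℂ| ≤ ‖⟪(T - S) x, x⟫_ℂ‖ := RCLike.abs_re_le_norm _
    _ ≤ ‖(T - S) x‖ * ‖x‖ := norm_inner_le_norm _ _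
    _ ≤ ‖T - S‖ * ‖x‖ * ‖x‖ := by gcongr; exact (T - S).le_opNorm x
    _ = _ := by ring

theorem FormLowerBound.perturb {T S : G →L[ℂ] G} {c δ : ℝ} {n : ℕ}
    (h : FormLowerBound T c n) (hTS : ‖T - S‖ ≤ δ) : FormLowerBound S (c - δ) n := by
  obtain ⟨W, hW, hn, hc⟩ := h
  refine ⟨W, hW, hn, fun x hx => ?_⟩
  have h1 := (abs_le.1 (abs_reApplyInnerSelf_sub_le T S x)).2
  have h2 := mul_le_mul_of_nonneg_right hTS (sq_nonneg ‖x‖)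
  linarith [hc x hx]

theorem FormUpperBound.perturb {T S : G →L[ℂ] G} {c δ : ℝ} {n : ℕ}
    (h : FormUpperBound T c n) (hTS : ‖T - S‖ ≤ δ) : FormUpperBound S (c + δ) n := by
  obtain ⟨W, hW, hn, hc⟩ := h
  refine ⟨W, hW, hn, fun x hx => ?_⟩
  have h1 := (abs_le.1 (abs_reApplyInnerSelf_sub_le T S x)).1
  have h2 := mul_le_mul_of_nonneg_right hTS (sq_nonneg ‖x‖)
  linarith [hc x hx]

theorem FormUpperBound.mono {T : G →L[ℂ] G} {c c' : ℝ} {n : ℕ}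
    (h : FormUpperBound T c n) (hcc : c ≤ c') : FormUpperBound T c' n := by
  obtain ⟨W, hW, hn, hc⟩ := h
  exact ⟨W, hW, hn, fun x hx => (hc x hx).trans (by gcongr)⟩

end Forms

/-! ### Spectral bounds for symmetric operators -/

section Symmetric

variable {G : Type*} [NormedAddCommGroup G] [InnerProductSpace ℂ G] {T : G →L[ℂ] G}

theorem LinearMap.IsSymmetric.inner_eq_zero_of_eigenvectors (hs : T.IsSymmetric) {x y : G}
    {ν μ : ℝ} (hx : T x = (ν : ℂ) • x) (hy : T y = (μ : ℂ) • y) (hne : ν ≠ μ) :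
    ⟪x, y⟫_ℂ = 0 := by
  have h : ⟪T x, y⟫_ℂ = ⟪x, T y⟫_ℂ := hs x y
  rw [hx, hy, inner_smul_left, inner_smul_right, Complex.conj_ofReal] at h
  have hne' : (ν : ℂ) - μ ≠ 0 := by
    rw [← Complex.ofReal_sub]; exact_mod_cast sub_ne_zero.2 hne
  exact (mul_eq_zero.1 (show ((ν : ℂ) - μ) * ⟪x, y⟫_ℂ = 0 by rw [sub_mul, h, sub_self])).resolve_left
    hne'

theorem LinearMap.IsSymmetric.reApplyInnerSelf_le_of_spectrum [CompleteSpace G]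
    (hs : T.IsSymmetric) {c : ℝ} (h : ∀ ν : ℝ, (ν : ℂ) ∈ spectrum ℂ T → ν ≤ c) (x : G) :
    T.reApplyInnerSelf x ≤ c * ‖x‖ ^ 2 := by
  have hsa : IsSelfAdjoint T := hs.isSelfAdjoint
  have hle : T ≤ algebraMap ℝ (G →L[ℂ] G) c := by
    rw [le_algebraMap_iff_spectrum_le]
    exact fun ν hν => h ν (spectrum.algebraMap_mem ℂ hν)
  have := ((ContinuousLinearMap.le_def _ _).1 hle).re_inner_nonneg_left x
  simp only [_root_.sub_apply, inner_sub_left, map_sub] at this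
  have h2 : RCLike.re ⟪(algebraMap ℝ (G →L[ℂ] G) c) x, x⟫_ℂ = c * ‖x‖ ^ 2 := by
    have : (algebraMap ℝ (G →L[ℂ] G) c) x = (c : ℂ) • x := by
      rw [Algebra.algebraMap_eq_smul_one]; simp
    rw [this, inner_smul_left, inner_self_eq_norm_sq_to_K]
    simp [← Complex.ofReal_pow]
  rw [ContinuousLinearMap.reApplyInnerSelf_apply]
  linarith

theorem LinearMap.IsSymmetric.le_reApplyInnerSelf_of_spectrum [CompleteSpace G]
    (hs : T.IsSymmetric) {c : ℝ} (h : ∀ ν : ℝ, (ν : ℂ) ∈ spectrum ℂ T → c ≤ ν) (x : G) :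
    c * ‖x‖ ^ 2 ≤ T.reApplyInnerSelf x := by
  have hs' : (-T).IsSymmetric := fun x y => by
    have : ⟪T x, y⟫_ℂ = ⟪x, T y⟫_ℂ := hs x y
    simp [this]
  have := hs'.reApplyInnerSelf_le_of_spectrum (c := -c) (fun ν hν => by
    have := h (-ν) (by rw [← spectrum.neg_eq] at hν; simpa using hν)
    linarith) x
  simp only [ContinuousLinearMap.reApplyInnerSelf_apply, _root_.neg_apply,
    inner_neg_left, map_neg] at this ⊢
  linarith

/-- The quadratic form on the span of eigenvectors is bounded below by a lower bound of the
eigenvalues. -/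
theorem LinearMap.IsSymmetric.le_reApplyInnerSelf_of_mem_span (hs : T.IsSymmetric) {ι : Type*}
    [Finite ι] {v : ι → G} {ν : ι → ℝ} (hv : ∀ i, T (v i) = (ν i : ℂ) • v i) {c : ℝ}
    (hc : ∀ i, c ≤ ν i) {x : G} (hx : x ∈ Submodule.span ℂ (Set.range v)) :
    c * ‖x‖ ^ 2 ≤ T.reApplyInnerSelf x := by
  set W := Submodule.span ℂ (Set.range v) with hW
  have hfd : FiniteDimensional ℂ W := FiniteDimensional.span_of_finite ℂ (finite_range v)
  have : CompleteSpace W := FiniteDimensional.complete ℂ W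
  have hinv : Set.MapsTo T W W := by
    intro y hy
    induction hy using Submodule.span_induction with
    | mem y hy =>
      obtain ⟨i, rfl⟩ := hy
      rw [hv]
      exact W.smul_mem _ (Submodule.subset_span ⟨i, rfl⟩)
    | zero => simp
    | add y z _ _ hy hz => rw [map_add]; exact W.add_mem hy hz
    | smul a y _ hy => rw [map_smul]; exact W.smul_mem _ hy
  let S : W →L[ℂ] W := T.restrict hinv
  have hS : S.IsSymmetric := hs.restrict_invariant hinv
  refine hS.le_reApplyInnerSelf_of_spectrum (c := c) (fun μ hμ => ?_) ⟨x, hx⟩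
  rw [ContinuousLinearMap.spectrum_eq, ← Module.End.hasEigenvalue_iff_mem_spectrum] at hμ
  obtain ⟨⟨y, hyW⟩, hy⟩ := hμ.exists_hasEigenvector
  have hTy : T y = (μ : ℂ) • y := congrArg Subtype.val hy.apply_eq_smul
  by_contra! hlt
  -- An eigenvalue below `c` differs from every `ν i`, so `y` is orthogonal to the spanning vectors;
  -- since `y` lies in their span, it is orthogonal to itself.
  have hperp : W ≤ (ℂ ∙ y)ᗮ := by
    rw [hW, Submodule.span_le]
    rintro _ ⟨i, rfl⟩
    rw [SetLike.mem_coe, Submodule.mem_orthogonal_singleton_iff_inner_right]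
    exact hs.inner_eq_zero_of_eigenvectors hTy (hv i) (hlt.trans_le (hc i)).ne
  have h0 := Submodule.mem_orthogonal_singleton_iff_inner_right.1 (hperp hyW)
  exact hy.2 (by simpa using h0)

theorem HasEigenvaluesIn.formLowerBound (hs : T.IsSymmetric) {n : ℕ} {c : ℝ}
    (h : HasEigenvaluesIn (T : G →ₗ[ℂ] G) n (Ici c)) : FormLowerBound T c n := by
  obtain ⟨v, hli, hv⟩ := h
  choose ν hν hv using hv
  refine ⟨Submodule.span ℂ (range v), FiniteDimensional.span_of_finite ℂ (finite_range v), ?_,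
    fun x hx => hs.le_reApplyInnerSelf_of_mem_span hv hν hx⟩
  rw [finrank_span_eq_card hli, Fintype.card_fin]

end Symmetric

/-! ### Min-max dichotomy for compact operators -/

section Compact

variable {G : Type*} [NormedAddCommGroup G] [InnerProductSpace ℂ G] [CompleteSpace G]
  {T : G →L[ℂ] G}

theorem IsCompactOperator.exists_lt_reApplyInnerSelf_le (hc : IsCompactOperator T)
    (hs : T.IsSymmetric) {c : ℝ} (hc0 : 0 < c)
    (h : ∀ ν : ℝ, Module.End.HasEigenvalue (T : G →ₗ[ℂ] G) (ν : ℂ) → ν < c) :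
    ∃ c' < c, ∀ x, T.reApplyInnerSelf x ≤ c' * ‖x‖ ^ 2 := by
  -- Cutting the spectrum at `c / 2 > 0` discards 0, the only point that may fail to be an
  -- eigenvalue. What is left is closed and below `c`, so its supremum is attained and strictly
  -- below `c`.
  let K : Set ℝ := {ν | (ν : ℂ) ∈ spectrum ℂ T} ∩ Ici (c / 2)
  have hcl : IsClosed K :=
    ((spectrum.isClosed T).preimage Complex.continuous_ofReal).inter isClosed_Ici
  have hlt : ∀ ν ∈ K, ν < c := fun ν hν => by
    have h0 : (ν : ℂ) ≠ 0 := by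
      have : c / 2 ≤ ν := hν.2
      exact_mod_cast (by linarith : 0 < ν).ne'
    exact h ν ((hc.hasEigenvalue_iff_mem_spectrum h0).2 hν.1)
  have key : ∀ c', c / 2 ≤ c' → (∀ ν ∈ K, ν ≤ c') →
      ∀ x, T.reApplyInnerSelf x ≤ c' * ‖x‖ ^ 2 := fun c' h1 h2 =>
    hs.reApplyInnerSelf_le_of_spectrum fun ν hν => by
      rcases le_total (c / 2) ν with h3 | h3
      · exact h2 ν ⟨hν, h3⟩
      · exact h3.trans h1
  rcases K.eq_empty_or_nonempty with hK | hK
  · exact ⟨c / 2, by linarith, key _ le_rfl (by simp [hK])⟩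
  · have hb : BddAbove K := ⟨c, fun ν hν => (hlt ν hν).le⟩
    have hm := hcl.csSup_mem hK hb
    exact ⟨sSup K, hlt _ hm, key _ hm.2 fun ν hν => le_csSup hb hν⟩

/-- If the first alternative fails, the eigenvectors with eigenvalue in `Ici c` span a space `W` of
dimension less than `n`. On the invariant complement `T` is compact with all eigenvalues below `c`.
The strict gap `c' < c` lets form bounds be turned back into eigenvalues. -/
theorem hasEigenvaluesIn_or_formUpperBound (hc : IsCompactOperator T) (hs : T.IsSymmetric)
    {c : ℝ} (hc0 : 0 < c) (n : ℕ) :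
    HasEigenvaluesIn (T : G →ₗ[ℂ] G) n (Ici c) ∨ ∃ c' < c, FormUpperBound T c' n := by
  by_cases h : HasEigenvaluesIn (T : G →ₗ[ℂ] G) n (Ici c)
  · exact Or.inl h
  right
  let E : Set G := {x | ∃ ν ∈ Ici c, T x = (ν : ℂ) • x}
  obtain ⟨b, hbE, hbs, hbi⟩ := exists_linearIndependent ℂ E
  have hbn : b.encard < n := by
    by_contra! hle
    obtain ⟨t, htb, htn⟩ := Set.exists_subset_encard_eq hle
    have htf : t.Finite := Set.finite_of_encard_eq_coe htn
    have := htf.fintype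
    have hcard : Fintype.card t = n := by
      rw [← Nat.card_eq_fintype_card, Nat.card_coe_set_eq, Set.ncard, htn]; rfl
    let e := (Fintype.equivFinOfCardEq hcard).symm
    refine h ⟨fun i => (e i : G), ?_, fun i => hbE (htb (e i).2)⟩
    exact hbi.comp (fun i => (⟨e i, htb (e i).2⟩ : b)) fun i j hij =>
      e.injective (Subtype.ext (congrArg (fun z : b => (z : G)) hij))
  have hbf : b.Finite := Set.finite_of_encard_le_coe hbn.le
  have := hbf.fintype
  let W := Submodule.span ℂ E
  have hWb : W = Submodule.span ℂ (range ((↑) : b → G)) := by rw [Subtype.range_coe, hbs]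
  have hfd : FiniteDimensional ℂ W := by
    rw [hWb]; exact FiniteDimensional.span_of_finite ℂ (finite_range _)
  have hrank : Module.finrank ℂ W < n := by
    rw [hWb, finrank_span_eq_card hbi]
    rw [Set.encard_eq_coe_toFinset_card, Set.toFinset_card] at hbn
    exact_mod_cast hbn
  have hinv : MapsTo T Wᗮ Wᗮ := by
    intro y hy
    have hle : W ≤ (ℂ ∙ (T y))ᗮ := by
      refine Submodule.span_le.2 fun x hx => ?_
      rw [SetLike.mem_coe, Submodule.mem_orthogonal_singleton_iff_inner_right]
      obtain ⟨ν, _, hν⟩ := id hx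
      have h1 : ⟪T y, x⟫_ℂ = ⟪y, T x⟫_ℂ := hs y x
      rw [h1, hν, inner_smul_right,
        Submodule.inner_left_of_mem_orthogonal (Submodule.subset_span hx) hy, mul_zero]
    rw [SetLike.mem_coe, Submodule.mem_orthogonal']
    exact fun x hx => Submodule.mem_orthogonal_singleton_iff_inner_right.1 (hle hx)
  let S : Wᗮ →L[ℂ] Wᗮ := T.restrict hinv
  have hSc : IsCompactOperator S := hc.restrict' hinv
  have hSs : S.IsSymmetric := hs.restrict_invariant hinv
  have hSlt : ∀ ν : ℝ, Module.End.HasEigenvalue (S : Wᗮ →ₗ[ℂ] Wᗮ) (ν : ℂ) → ν < c := by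
    intro ν hν
    obtain ⟨⟨y, hyW⟩, hy⟩ := hν.exists_hasEigenvector
    have hTy : T y = (ν : ℂ) • y := congrArg Subtype.val hy.apply_eq_smul
    by_contra! hle
    have hyW' : y ∈ W := Submodule.subset_span ⟨ν, hle, hTy⟩
    exact hy.2 (by simpa using Submodule.inner_right_of_mem_orthogonal hyW' hyW)
  obtain ⟨c', hc', hle⟩ := hSc.exists_lt_reApplyInnerSelf_le hSs hc0 hSlt
  exact ⟨c', hc', W, hfd, hrank, fun x hx => hle ⟨x, hx⟩⟩

theorem FormLowerBound.hasEigenvaluesIn (hc : IsCompactOperator T) (hs : T.IsSymmetric)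
    {c : ℝ} (hc0 : 0 < c) {n : ℕ} (h : FormLowerBound T c n) :
    HasEigenvaluesIn (T : G →ₗ[ℂ] G) n (Ici c) := by
  refine (hasEigenvaluesIn_or_formUpperBound hc hs hc0 n).resolve_right ?_
  rintro ⟨c', hlt, h'⟩
  exact absurd (h.le_of_upperBound h') hlt.not_ge

end Compact

/-! ### Counting eigenvalues -/

section Counting

variable {G : Type*} [AddCommGroup G] [Module ℂ G] {T : Module.End ℂ G}

theorem HasEigenvaluesIn.mono {n : ℕ} {I I' : Set ℝ} (h : HasEigenvaluesIn T n I) (hI : I ⊆ I') :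
    HasEigenvaluesIn T n I' := by
  obtain ⟨v, hli, hv⟩ := h
  refine ⟨v, hli, fun i => ?_⟩
  obtain ⟨ν, hν, h⟩ := hv i
  exact ⟨ν, hI hν, h⟩

theorem HasEigenvaluesIn.of_le {m n : ℕ} {I : Set ℝ} (h : HasEigenvaluesIn T n I) (hmn : m ≤ n) :
    HasEigenvaluesIn T m I := by
  obtain ⟨v, hli, hv⟩ := h
  exact ⟨v ∘ Fin.castLE hmn, hli.comp _ (Fin.castLE_injective hmn), fun i => hv _⟩

theorem HasEigenvaluesIn.exists_Ici {n : ℕ} {I : Set ℝ} (h : HasEigenvaluesIn T n I)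
    (hI : I.Nonempty) : ∃ ν ∈ I, HasEigenvaluesIn T n (Ici ν) := by
  obtain ⟨v, hli, hv⟩ := h
  choose ν hν hv using hv
  rcases isEmpty_or_nonempty (Fin n) with hn | hn
  · exact ⟨_, hI.some_mem, v, hli, fun i => isEmptyElim i⟩
  · obtain ⟨i, hi⟩ := Finite.exists_min ν
    exact ⟨ν i, hν i, v, hli, fun j => ⟨ν j, hi j, hv j⟩⟩

theorem HasEigenvaluesIn.exists_hasEigenvalue {n : ℕ} {I : Set ℝ} (hn : 1 ≤ n)
    (h : HasEigenvaluesIn T n I) :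
    ∃ ν ∈ I, Module.End.HasEigenvalue T (ν : ℂ) ∧ HasEigenvaluesIn T n (Ici ν) := by
  obtain ⟨v, hli, hv⟩ := h
  choose ν hν hv using hv
  have : Nonempty (Fin n) := ⟨⟨0, hn⟩⟩
  obtain ⟨i, hi⟩ := Finite.exists_min ν
  exact ⟨ν i, hν i, Module.End.hasEigenvalue_of_hasEigenvector
    (Module.End.hasEigenvector_iff.2 ⟨Module.End.mem_eigenspace_iff.2 (hv i), hli.ne_zero i⟩),
    v, hli, fun j => ⟨ν j, hi j, hv j⟩⟩

/-- Removing one eigenvector removes a simple eigenvalue. -/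
theorem HasEigenvaluesIn.Ioi_of_Ici {n : ℕ} {c : ℝ} (h : HasEigenvaluesIn T (n + 1) (Ici c))
    (hc : Module.finrank ℂ (Module.End.eigenspace T (c : ℂ)) = 1) :
    HasEigenvaluesIn T n (Ioi c) := by
  obtain ⟨v, hli, hv⟩ := h
  choose ν hν hv using hv
  have hunique : ∀ i j, ν i = c → ν j = c → i = j := by
    intro i j hi hj
    by_contra hij
    have hmem : ∀ k, ν k = c → v k ∈ Module.End.eigenspace T (c : ℂ) := fun k hk =>
      Module.End.mem_eigenspace_iff.2 (by rw [hv k, hk])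
    obtain ⟨u, -, hu⟩ := finrank_eq_one_iff'.1 hc
    obtain ⟨a, ha⟩ := hu ⟨v i, hmem i hi⟩
    obtain ⟨b, hb⟩ := hu ⟨v j, hmem j hj⟩
    have ha' : a • (u : G) = v i := congrArg Subtype.val ha
    have hb' : b • (u : G) = v j := congrArg Subtype.val hb
    have hinj : Function.Injective ![i, j] := by
      intro k l hkl
      fin_cases k <;> fin_cases l <;> simp_all
    have hp : LinearIndependent ℂ ![v i, v j] := by
      convert! hli.comp ![i, j] hinj using 1
      ext k
      fin_cases k <;> rfl
    have hb0 : b = 0 := (LinearIndependent.pair_iff.1 hp b (-a) (by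
      rw [← ha', ← hb', smul_smul, smul_smul, neg_mul, mul_comm b a, neg_smul, add_neg_cancel])).1
    exact hli.ne_zero j (by rw [← hb', hb0, zero_smul])
  obtain ⟨i₀, hi₀⟩ : ∃ i₀, ∀ i, i ≠ i₀ → ν i ≠ c := by
    by_cases hex : ∃ i, ν i = c
    · obtain ⟨i₀, hi₀⟩ := hex
      exact ⟨i₀, fun i hi h => hi (hunique i i₀ h hi₀)⟩
    · push Not at hex
      -- No eigenvalue equals `c`, so any index may be dropped.
      exact ⟨0, fun i _ => hex i⟩
  exact ⟨v ∘ i₀.succAbove, hli.comp _ Fin.succAbove_right_injective, fun i =>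
    ⟨ν (i₀.succAbove i), lt_of_le_of_ne (hν _) (hi₀ _ (Fin.succAbove_ne i₀ i)).symm, hv _⟩⟩

end Counting

/-! ### The n-th eigenvalue and its isolation -/

section NthEigenvalue

variable {G : Type*} [NormedAddCommGroup G] [InnerProductSpace ℂ G] {T : G →L[ℂ] G}

theorem ContinuousLinearMap.le_opNorm_of_hasEigenvalue {ν : ℝ}
    (h : Module.End.HasEigenvalue (T : G →ₗ[ℂ] G) (ν : ℂ)) : ν ≤ ‖T‖ := by
  obtain ⟨x, hx⟩ := h.exists_hasEigenvector
  have hTx : T x = (ν : ℂ) • x := hx.apply_eq_smul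
  have h1 := T.le_opNorm x
  rw [hTx, norm_smul, Complex.norm_real] at h1
  exact (le_abs_self ν).trans (le_of_mul_le_mul_right h1 (norm_pos_iff.2 hx.2))

theorem bddAbove_nthEigenvalue_set (T : G →L[ℂ] G) (n : ℕ) :
    BddAbove {μ : ℝ | Module.End.HasEigenvalue (T : G →ₗ[ℂ] G) (μ : ℂ) ∧
      HasEigenvaluesIn (T : G →ₗ[ℂ] G) n (Ici μ)} :=
  ⟨‖T‖, fun _ h => ContinuousLinearMap.le_opNorm_of_hasEigenvalue h.1⟩

theorem HasEigenvaluesIn.le_nthEigenvalue {n : ℕ} (hn : 1 ≤ n) {c : ℝ}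
    (h : HasEigenvaluesIn (T : G →ₗ[ℂ] G) n (Ici c)) :
    c ≤ nthEigenvalue (T : G →ₗ[ℂ] G) n := by
  obtain ⟨ν, hν, h'⟩ := h.exists_hasEigenvalue hn
  exact le_trans hν (le_csSup (bddAbove_nthEigenvalue_set T n) h')

/-- The bounds that isolate the `n + 1`-st largest eigenvalue in the interval `(b, a)`. -/
structure IsolatesEigenvalue (T : G →L[ℂ] G) (n : ℕ) (b c₁ c₂ a : ℝ) : Prop where
  lower : FormLowerBound T c₁ (n + 1)
  lower_gap : FormLowerBound T a n
  upper : FormUpperBound T c₂ (n + 1)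
  upper_gap : FormUpperBound T b (n + 2)

theorem IsolatesEigenvalue.perturb {n : ℕ} {b c₁ c₂ a : ℝ}
    (h : IsolatesEigenvalue T n b c₁ c₂ a) {S : G →L[ℂ] G} {δ : ℝ}
    (hTS : ‖T - S‖ ≤ δ) : IsolatesEigenvalue S n (b + δ) (c₁ - δ) (c₂ + δ) (a - δ) :=
  ⟨h.lower.perturb hTS, h.lower_gap.perturb hTS, h.upper.perturb hTS, h.upper_gap.perturb hTS⟩

variable [CompleteSpace G]

/-- The supremum is attained: otherwise the form has an upper bound `c' < l`, which contradicts a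
member of the set between `c'` and `l`. -/
theorem HasEigenvaluesIn.nthEigenvalue_mem (hc : IsCompactOperator T) (hs : T.IsSymmetric)
    {n : ℕ} (hn : 1 ≤ n) {c : ℝ} (hc0 : 0 < c)
    (h : HasEigenvaluesIn (T : G →ₗ[ℂ] G) n (Ici c)) :
    Module.End.HasEigenvalue (T : G →ₗ[ℂ] G) (nthEigenvalue (T : G →ₗ[ℂ] G) n : ℂ) ∧
      HasEigenvaluesIn (T : G →ₗ[ℂ] G) n (Ici (nthEigenvalue (T : G →ₗ[ℂ] G) n)) := by
  set l := nthEigenvalue (T : G →ₗ[ℂ] G) n with hl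
  have hcl : c ≤ l := h.le_nthEigenvalue hn
  have hne : {μ : ℝ | Module.End.HasEigenvalue (T : G →ₗ[ℂ] G) (μ : ℂ) ∧
      HasEigenvaluesIn (T : G →ₗ[ℂ] G) n (Ici μ)}.Nonempty := by
    obtain ⟨ν, -, h'⟩ := h.exists_hasEigenvalue hn
    exact ⟨ν, h'⟩
  have hE : HasEigenvaluesIn (T : G →ₗ[ℂ] G) n (Ici l) := by
    refine (hasEigenvaluesIn_or_formUpperBound hc hs (hc0.trans_le hcl) n).resolve_right ?_
    rintro ⟨c', hlt, hup⟩
    obtain ⟨μ, hμ, hlt'⟩ := exists_lt_of_lt_csSup hne hlt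
    exact absurd ((hμ.2.formLowerBound hs).le_of_upperBound hup) hlt'.not_ge
  obtain ⟨ν, hν, h'⟩ := hE.exists_hasEigenvalue hn
  have hνl : ν = l := le_antisymm (le_csSup (bddAbove_nthEigenvalue_set T n) h') hν
  exact hνl ▸ h'

namespace IsolatesEigenvalue

variable {n : ℕ} {b c₁ c₂ a : ℝ}

theorem nthEigenvalue_mem (h : IsolatesEigenvalue T n b c₁ c₂ a) (hc : IsCompactOperator T)
    (hs : T.IsSymmetric) (h0 : 0 < c₁) :
    Module.End.HasEigenvalue (T : G →ₗ[ℂ] G) (nthEigenvalue (T : G →ₗ[ℂ] G) (n + 1) : ℂ) ∧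
      nthEigenvalue (T : G →ₗ[ℂ] G) (n + 1) ∈ Icc c₁ c₂ := by
  have h1 := h.lower.hasEigenvaluesIn hc hs h0
  have h2 := h1.nthEigenvalue_mem hc hs (by omega) h0
  exact ⟨h2.1, h1.le_nthEigenvalue (by omega), (h2.2.formLowerBound hs).le_of_upperBound h.upper⟩

/-- Otherwise `x`, `y` and `n` eigenvectors with eigenvalues at least `a` would give `n + 2`
eigenvalues above `b`, against `upper_gap`. -/
theorem eq_zero_of_inner_eq_zero (h : IsolatesEigenvalue T n b c₁ c₂ a)
    (hc : IsCompactOperator T) (hs : T.IsSymmetric) (ha : 0 < a) {ν μ : ℝ}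
    (hν : ν ∈ Ioo b a) (hμ : μ ∈ Ioo b a) {x y : G} (hx : T x = (ν : ℂ) • x)
    (hy : T y = (μ : ℂ) • y) (hxy : ⟪x, y⟫_ℂ = 0) (hx0 : x ≠ 0) : y = 0 := by
  by_contra hy0
  obtain ⟨v, hli, hv⟩ := h.lower_gap.hasEigenvaluesIn hc hs ha
  choose ρ hρ hv using hv
  have hne_y : y ∉ Submodule.span ℂ (range v) := fun hmem => by
    have hle : Submodule.span ℂ (range v) ≤ (ℂ ∙ y)ᗮ := by
      refine Submodule.span_le.2 ?_
      rintro _ ⟨i, rfl⟩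
      rw [SetLike.mem_coe, Submodule.mem_orthogonal_singleton_iff_inner_right]
      exact hs.inner_eq_zero_of_eigenvectors hy (hv i) (hμ.2.trans_le (hρ i)).ne
    exact hy0 (by simpa using Submodule.mem_orthogonal_singleton_iff_inner_right.1 (hle hmem))
  have hliy : LinearIndependent ℂ (Fin.cons y v : Fin (n + 1) → G) :=
    linearIndependent_finCons.2 ⟨hli, hne_y⟩
  have hne_x : x ∉ Submodule.span ℂ (range (Fin.cons y v : Fin (n + 1) → G)) := fun hmem => by
    have hle : Submodule.span ℂ (range (Fin.cons y v : Fin (n + 1) → G)) ≤ (ℂ ∙ x)ᗮ := by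
      refine Submodule.span_le.2 ?_
      rintro _ ⟨i, rfl⟩
      rw [SetLike.mem_coe, Submodule.mem_orthogonal_singleton_iff_inner_right]
      refine Fin.cases ?_ (fun i => ?_) i
      · simpa using hxy
      · simpa using hs.inner_eq_zero_of_eigenvectors hx (hv i) (hν.2.trans_le (hρ i)).ne
    exact hx0 (by simpa using Submodule.mem_orthogonal_singleton_iff_inner_right.1 (hle hmem))
  have hlix : LinearIndependent ℂ (Fin.cons x (Fin.cons y v) : Fin (n + 2) → G) :=
    linearIndependent_finCons.2 ⟨hliy, hne_x⟩
  have hE : HasEigenvaluesIn (T : G →ₗ[ℂ] G) (n + 2) (Ici (min ν μ)) := by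
    refine ⟨_, hlix, fun i => ?_⟩
    refine Fin.cases ⟨ν, mem_Ici.2 (min_le_left _ _), by simpa using hx⟩ (fun i => ?_) i
    refine Fin.cases ⟨μ, mem_Ici.2 (min_le_right _ _), by simpa using hy⟩ (fun i => ?_) i
    exact ⟨ρ i, mem_Ici.2 ((min_le_left _ _).trans (hν.2.le.trans (hρ i))), by simpa using hv i⟩
  exact absurd ((hE.formLowerBound hs).le_of_upperBound h.upper_gap) (lt_min hν.1 hμ.1).not_ge

/-- This identifies a smooth eigenvalue branch as the `n + 1`-st one: distinct eigenvalues in the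
window would have orthogonal eigenvectors. -/
theorem eq_nthEigenvalue (h : IsolatesEigenvalue T n b c₁ c₂ a) (hc : IsCompactOperator T)
    (hs : T.IsSymmetric) (h0 : 0 < c₁) (hb : b < c₁) (ha : c₂ < a) {ν : ℝ} (hν : ν ∈ Ioo b a)
    (hE : Module.End.HasEigenvalue (T : G →ₗ[ℂ] G) (ν : ℂ)) :
    nthEigenvalue (T : G →ₗ[ℂ] G) (n + 1) = ν := by
  obtain ⟨hE', hm⟩ := h.nthEigenvalue_mem hc hs h0
  obtain ⟨x, hx⟩ := hE.exists_hasEigenvector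
  obtain ⟨y, hy⟩ := hE'.exists_hasEigenvector
  have hTx : T x = (ν : ℂ) • x := hx.apply_eq_smul
  have hTy : T y = (nthEigenvalue (T : G →ₗ[ℂ] G) (n + 1) : ℂ) • y := hy.apply_eq_smul
  by_contra hne
  exact hy.2 (h.eq_zero_of_inner_eq_zero hc hs (h0.trans_le (hm.1.trans (hm.2.trans ha.le))) hν
    ⟨hb.trans_le hm.1, hm.2.trans_lt ha⟩ hTx hTy
    (hs.inner_eq_zero_of_eigenvectors hTx hTy (Ne.symm hne)) hx.2)

end IsolatesEigenvalue

/-- A simple positive eigenvalue of a compact self-adjoint operator is isolated. -/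
theorem IsSimpleNthEigenvalue.exists_isolatesEigenvalue (hc : IsCompactOperator T)
    (hs : T.IsSymmetric) {n : ℕ}
    (hpos : HasEigenvaluesIn (T : G →ₗ[ℂ] G) (n + 1) (Ioi 0))
    (hsimple : IsSimpleNthEigenvalue (T : G →ₗ[ℂ] G) (n + 1)) :
    ∃ l δ : ℝ, 0 < δ ∧ 20 * δ ≤ l ∧
      IsolatesEigenvalue T n (l - 10 * δ) l (l + δ) (l + 10 * δ) := by
  obtain ⟨c, hc0, hE⟩ := hpos.exists_Ici ⟨1, mem_Ioi.2 one_pos⟩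
  have hc0 : 0 < c := hc0
  obtain ⟨-, hl⟩ := hE.nthEigenvalue_mem hc hs (by omega) hc0
  have hcl := hE.le_nthEigenvalue (T := T) (by omega)
  have hbdd := bddAbove_nthEigenvalue_set T (n + 1)
  have hle_l : ∀ μ : ℝ, HasEigenvaluesIn (T : G →ₗ[ℂ] G) (n + 1) (Ici μ) →
      μ ≤ nthEigenvalue (T : G →ₗ[ℂ] G) (n + 1) := fun μ h => h.le_nthEigenvalue (by omega)
  unfold IsSimpleNthEigenvalue at hsimple
  generalize nthEigenvalue (T : G →ₗ[ℂ] G) (n + 1) = l at *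
  have hl0 : 0 < l := hc0.trans_le hcl
  obtain ⟨a, ha, hEa⟩ := (hl.Ioi_of_Ici hsimple).exists_Ici ⟨l + 1, by simp⟩
  have ha : l < a := ha
  -- With `n + 2` eigenvalues in `Ici l`, dropping one would leave `n + 1` strictly above `l`,
  -- against the maximality of `l`.
  obtain ⟨b, hb, hUb⟩ := (hasEigenvaluesIn_or_formUpperBound hc hs hl0 (n + 2)).resolve_left
    fun h => by
      obtain ⟨μ, hμ, h'⟩ := (h.Ioi_of_Ici hsimple).exists_Ici ⟨l + 1, by simp⟩
      exact (hle_l μ h').not_gt hμ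
  obtain ⟨δ, hδ, h1, h2, h3⟩ : ∃ δ : ℝ, 0 < δ ∧ 10 * δ ≤ a - l ∧ 10 * δ ≤ l - b ∧ 20 * δ ≤ l := by
    -- Margins of `10 * δ` leave room for later perturbations, and `20 * δ ≤ l` keeps all later
    -- bounds positive.
    refine ⟨min (min (a - l) (l - b)) l / 20, ?_, ?_, ?_, ?_⟩
    · have : 0 < min (min (a - l) (l - b)) l := lt_min (lt_min (by linarith) (by linarith)) hl0
      linarith
    · have : min (min (a - l) (l - b)) l ≤ a - l := (min_le_left _ _).trans (min_le_left _ _)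
      linarith
    · have : min (min (a - l) (l - b)) l ≤ l - b := (min_le_left _ _).trans (min_le_right _ _)
      linarith
    · have : min (min (a - l) (l - b)) l ≤ l := min_le_right _ _
      linarith
  obtain ⟨c', hc', hU⟩ := (hasEigenvaluesIn_or_formUpperBound hc hs
    (show 0 < l + δ by linarith) (n + 1)).resolve_left fun h => by linarith [hle_l _ h]
  exact ⟨l, δ, hδ, h3, hl.formLowerBound hs,
    (hEa.mono (Ici_subset_Ici.2 (by linarith))).formLowerBound hs, hU.mono hc'.le,
    hUb.mono (by linarith)⟩

end NthEigenvalue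

/-! ### Smooth dependence of a simple eigenvalue on the operator -/

section SmoothEigenvalue

variable {G : Type*} [NormedAddCommGroup G] [InnerProductSpace ℂ G] [CompleteSpace G]

/-- A simple isolated eigenvalue extends to a smooth function of the operator. -/
theorem IsCompactOperator.exists_contDiffAt_eigenvalue {T₀ : G →L[ℂ] G}
    (hc : IsCompactOperator T₀) (hs : T₀.IsSymmetric) {l : ℝ} (hl : l ≠ 0) {u : G}
    (hu : ‖u‖ = 1) (hTu : T₀ u = (l : ℂ) • u)
    (hsimple : ∀ x, T₀ x = (l : ℂ) • x → ⟪u, x⟫_ℂ = 0 → x = 0) :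
    ∃ Λ : (G →L[ℂ] G) → ℂ, ContDiffAt ℂ 3 Λ T₀ ∧ Λ T₀ = l ∧
      ∀ᶠ T : G →L[ℂ] G in 𝓝 T₀, Module.End.HasEigenvalue (T : G →ₗ[ℂ] G) (Λ T) := by
  have huu : ⟪u, u⟫_ℂ = 1 := by rw [inner_self_eq_norm_sq_to_K, hu]; simp
  -- The rank-one term `R` moves the eigenvalue `l` of `u` to `l + 1`, making `T₀ + R - l`
  -- invertible. If `x = (T + R - z)⁻¹ u` satisfies `⟪u, x⟫ = 1`, then `T x = z x`; so the scalar
  -- equation `g (T, z) = 1` is solved for `z`.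
  let R : G →L[ℂ] G := (innerSL ℂ u).smulRight u
  have hR : ∀ x, R x = ⟪u, x⟫_ℂ • u := fun x => rfl
  let M : (G →L[ℂ] G) × ℂ → (G →L[ℂ] G) := fun p => p.1 + R - p.2 • 1
  have hM : ∀ p x, M p x = p.1 x + ⟪u, x⟫_ℂ • u - p.2 • x := fun p x => rfl
  let g : (G →L[ℂ] G) × ℂ → ℂ := fun p =>
    innerSL ℂ u (ContinuousLinearMap.apply ℂ G u (Ring.inverse (M p)))
  have hg : ∀ p, g p = ⟪u, Ring.inverse (M p) u⟫_ℂ := fun p => rfl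
  have hlC : (l : ℂ) ≠ 0 := by exact_mod_cast hl
  have hunit : IsUnit (M (T₀, (l : ℂ))) := by
    have hRc : IsCompactOperator R := by
      have : IsCompactOperator (innerSL ℂ u) := by
        refine ⟨Metric.closedBall 0 1, isCompact_closedBall 0 1, ?_⟩
        exact (innerSL ℂ u).continuous.continuousAt.preimage_mem_nhds
          (by rw [map_zero]; exact Metric.closedBall_mem_nhds _ one_pos)
      exact this.clm_comp ((ContinuousLinearMap.id ℂ ℂ).smulRight u)
    have hns : ¬ Module.End.HasEigenvalue ((T₀ + R : G →L[ℂ] G) : G →ₗ[ℂ] G) (l : ℂ) := by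
      intro h
      obtain ⟨x, hx⟩ := h.exists_hasEigenvector
      have hTx : T₀ x + ⟪u, x⟫_ℂ • u = (l : ℂ) • x := hx.apply_eq_smul
      have h1 : ⟪u, T₀ x⟫_ℂ = l * ⟪u, x⟫_ℂ := by
        have : ⟪T₀ u, x⟫_ℂ = ⟪u, T₀ x⟫_ℂ := hs u x
        rw [← this, hTu, inner_smul_left, Complex.conj_ofReal]
      have h2 : ⟪u, x⟫_ℂ = 0 := by
        have := congrArg (fun z => ⟪u, z⟫_ℂ) hTx
        simp only [inner_add_right, inner_smul_right, h1, huu, mul_one] at this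
        exact add_eq_left.1 this
      exact hx.2 (hsimple x (by simpa [h2] using hTx) h2)
    have hres := ((hc.add hRc : IsCompactOperator (T₀ + R : G →L[ℂ] G)).hasEigenvalue_or_mem_resolventSet
      hlC).resolve_left hns
    rw [spectrum.mem_resolventSet_iff, ← IsUnit.neg_iff, neg_sub] at hres
    rwa [Algebra.algebraMap_eq_smul_one] at hres
  have hMc : ContDiff ℂ 3 M := by
    have h1 : ContDiff ℂ 3 (fun p : (G →L[ℂ] G) × ℂ => p.2 • (1 : G →L[ℂ] G)) :=
      contDiff_snd.smul contDiff_const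
    exact (contDiff_fst.add contDiff_const).sub h1
  have hgc : ContDiffAt ℂ 3 g (T₀, (l : ℂ)) := by
    obtain ⟨U, hU⟩ := hunit
    have h1 : ContDiffAt ℂ 3 (fun p => Ring.inverse (M p)) (T₀, (l : ℂ)) :=
      ContDiffAt.comp (g := Ring.inverse) (f := M) _ (hU ▸ contDiffAt_ringInverse ℂ U) hMc.contDiffAt
    exact (innerSL ℂ u).contDiff.contDiffAt.comp _
      ((ContinuousLinearMap.apply ℂ G u).contDiff.contDiffAt.comp _ h1)
  -- On `T = T₀` the vector `u` is an eigenvector of `M`, so `g` is explicit there and its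
  -- derivative in `z` at `l` is 1.
  have hgT : ∀ᶠ z : ℂ in 𝓝 (l : ℂ), g (T₀, z) = (1 + l - z)⁻¹ := by
    have hopen : ∀ᶠ z : ℂ in 𝓝 (l : ℂ), IsUnit (M (T₀, z)) := by
      have : Continuous fun z : ℂ => M (T₀, z) := hMc.continuous.comp (by fun_prop)
      exact this.continuousAt.eventually (Units.isOpen.mem_nhds hunit)
    have hne : ∀ᶠ z : ℂ in 𝓝 (l : ℂ), 1 + l - z ≠ 0 := by
      refine ContinuousAt.eventually_ne (by fun_prop) (by simp)
    filter_upwards [hopen, hne] with z hz hz0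
    have hMu : M (T₀, z) u = (1 + l - z) • u := by
      rw [hM, hTu, huu, ← add_smul, ← sub_smul, add_comm]
    have hinv : Ring.inverse (M (T₀, z)) (M (T₀, z) u) = u := by
      have := congrArg (fun S : G →L[ℂ] G => S u) (Ring.inverse_mul_cancel _ hz)
      exact this
    rw [hMu, map_smul] at hinv
    rw [hg, ← inv_smul_smul₀ hz0 (Ring.inverse (M (T₀, z)) u), hinv, inner_smul_right, huu,
      mul_one]
  have hg0 : g (T₀, (l : ℂ)) = 1 := by rw [hgT.self_of_nhds]; simp
  have hderiv : fderiv ℂ g (T₀, (l : ℂ)) ∘L .inr ℂ (G →L[ℂ] G) ℂ = ContinuousLinearMap.id ℂ ℂ := by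
    have h1 : HasFDerivAt (fun z : ℂ => g (T₀, z))
        (fderiv ℂ g (T₀, (l : ℂ)) ∘L .inr ℂ (G →L[ℂ] G) ℂ) (l : ℂ) :=
      HasFDerivAt.comp (l : ℂ) (hgc.differentiableAt (by norm_num)).hasFDerivAt
        (hasFDerivAt_prodMk_right T₀ (l : ℂ))
    have h2 : HasDerivAt (fun z : ℂ => (1 + (l : ℂ) - z)⁻¹) 1 (l : ℂ) := by
      have := (((hasDerivAt_id (l : ℂ)).const_sub (1 + (l : ℂ))).fun_inv (by simp))
      simpa using this
    have h3 := h2.congr_of_eventuallyEq hgT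
    ext
    have := (h1.hasDerivAt.unique h3)
    simpa using this
  have hinv : (fderiv ℂ g (T₀, (l : ℂ)) ∘L .inr ℂ (G →L[ℂ] G) ℂ).IsInvertible := by
    rw [hderiv]; exact ⟨ContinuousLinearEquiv.refl ℂ ℂ, rfl⟩
  refine ⟨hgc.implicitFunction (by norm_num) hinv, hgc.contDiffAt_implicitFunction _ hinv,
    hgc.implicitFunction_apply_self _ hinv, ?_⟩
  filter_upwards [hgc.eventually_apply_implicitFunction (by norm_num) hinv] with T hT
  set z := hgc.implicitFunction (by norm_num) hinv T
  rw [hg0] at hT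
  -- `Ring.inverse` is 0 at non-units, where `g` would be 0 instead of 1.
  have hz : IsUnit (M (T, z)) := by
    by_contra h
    rw [hg, Ring.inverse_non_unit _ h] at hT
    simp at hT
  set x := Ring.inverse (M (T, z)) u with hx
  have hux : ⟪u, x⟫_ℂ = 1 := hT
  have hMx : M (T, z) x = u := congrArg (fun S : G →L[ℂ] G => S u) (Ring.mul_inverse_cancel _ hz)
  rw [hM, hux, one_smul] at hMx
  refine Module.End.hasEigenvalue_of_hasEigenvector (x := x)
    (Module.End.hasEigenvector_iff.2 ⟨Module.End.mem_eigenspace_iff.2 ?_, ?_⟩)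
  · have : T x - z • x = 0 := by
      have h : T x - z • x = (T x + u - z • x) - u := by abel
      rw [h, hMx, sub_self]
    exact sub_eq_zero.1 this
  · rintro h
    rw [h, inner_zero_right] at hux
    exact zero_ne_one hux

end SmoothEigenvalue

/-! ### Norm convergence of corners -/

section Projections

variable {H : Type*} [NormedAddCommGroup H] [InnerProductSpace ℂ H]

/-- Strong convergence of contractions is uniform on compact sets, in particular on one containing
the image of the unit ball under `T`. A finite `ε / 6`-net leaves three errors of at most `ε / 6`.
-/
theorem IsCompactOperator.tendsto_comp_of_tendsto_apply {S : ℕ → H →L[ℂ] H} {S' T : H →L[ℂ] H}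
    (hT : IsCompactOperator T) (hS : ∀ k, ‖S k‖ ≤ 1) (hS' : ‖S'‖ ≤ 1)
    (h : ∀ x, Tendsto (fun k => S k x) atTop (𝓝 (S' x))) :
    Tendsto (fun k => S k ∘L T) atTop (𝓝 (S' ∘L T)) := by
  rw [Metric.tendsto_atTop]
  intro ε hε
  obtain ⟨K, hK, hsub⟩ := hT.image_closedBall_subset_compact 1
  obtain ⟨t, htf, htK⟩ := Metric.totallyBounded_iff.1 hK.totallyBounded (ε / 6) (by positivity)
  have hev : ∀ᶠ k in atTop, ∀ y ∈ t, ‖S k y - S' y‖ < ε / 6 := by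
    rw [htf.eventually_all]
    intro y _
    have := (tendsto_iff_norm_sub_tendsto_zero.1 (h y)).eventually_lt_const
      (show (0 : ℝ) < ε / 6 by positivity)
    exact this
  obtain ⟨N, hN⟩ := eventually_atTop.1 hev
  refine ⟨N, fun k hk => ?_⟩
  rw [dist_eq_norm]
  refine lt_of_le_of_lt ?_ (show ε / 2 < ε by linarith)
  refine ContinuousLinearMap.opNorm_le_of_unit_norm (by positivity) fun x hx => ?_
  have hTx : T x ∈ K := hsub ⟨x, by simp [hx], rfl⟩
  obtain ⟨y, hy, hxy⟩ := mem_iUnion₂.1 (htK hTx)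
  rw [Metric.mem_ball, dist_eq_norm] at hxy
  have h1 : ‖S k (T x - y)‖ ≤ ε / 6 := by
    have := (S k).le_of_opNorm_le (hS k) (T x - y)
    linarith
  have h2 : ‖S' (T x - y)‖ ≤ ε / 6 := by
    have := S'.le_of_opNorm_le hS' (T x - y)
    linarith
  have h3 := hN k hk y hy
  have heq : (S k ∘L T - S' ∘L T) x = S k (T x - y) + (S k y - S' y) - S' (T x - y) := by
    simp only [_root_.sub_apply, ContinuousLinearMap.comp_apply, map_sub]
    abel
  rw [heq]
  have h4 := norm_sub_le (S k (T x - y) + (S k y - S' y)) (S' (T x - y))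
  have h5 := norm_add_le (S k (T x - y)) (S k y - S' y)
  linarith

/-- The corner `P T P` of `T`, where `P` is the orthogonal projection onto `V`. -/
noncomputable def corner (T : H →L[ℂ] H) (V : Submodule ℂ H) [V.HasOrthogonalProjection] : H →L[ℂ] H :=
  V.starProjection ∘L T ∘L V.starProjection

theorem inner_corner (T : H →L[ℂ] H) (V : Submodule ℂ H) [V.HasOrthogonalProjection] (x y : H) :
    ⟪corner T V x, y⟫_ℂ = ⟪T (V.starProjection x), V.starProjection y⟫_ℂ :=
  V.inner_starProjection_left_eq_right _ _

theorem isSymmetric_corner {T : H →L[ℂ] H} (hs : T.IsSymmetric) (V : Submodule ℂ H)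
    [V.HasOrthogonalProjection] : (corner T V).IsSymmetric := fun x y => by
  have h1 : ⟪corner T V x, y⟫_ℂ = ⟪T (V.starProjection x), V.starProjection y⟫_ℂ :=
    inner_corner T V x y
  have h2 : ⟪T (V.starProjection x), V.starProjection y⟫_ℂ =
    ⟪V.starProjection x, T (V.starProjection y)⟫_ℂ := hs _ _
  exact h1.trans (h2.trans (V.inner_starProjection_left_eq_right _ _))

theorem isCompactOperator_corner {T : H →L[ℂ] H} (hc : IsCompactOperator T) (V : Submodule ℂ H)
    [V.HasOrthogonalProjection] : IsCompactOperator (corner T V) :=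
  (hc.comp_clm V.starProjection).clm_comp V.starProjection

theorem corner_sum {ι : Type*} (s : Finset ι) (a : ι → ℂ) (A : ι → H →L[ℂ] H) (V : Submodule ℂ H)
    [V.HasOrthogonalProjection] :
    corner (∑ i ∈ s, a i • A i) V = ∑ i ∈ s, a i • corner (A i) V := by
  ext x
  simp [corner]

/-- Strong convergence of `P k` gives `P k T → P' T` in norm, and adjoints give `T P k → T P'`. The
difference of corners is `P k (T P k - T P') + (P k - P') T P'`. -/
theorem tendsto_corner [CompleteSpace H] {T : H →L[ℂ] H} (hc : IsCompactOperator T)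
    (hs : T.IsSymmetric) {V : ℕ → Submodule ℂ H} [∀ k, (V k).HasOrthogonalProjection]
    (hV : Monotone V) :
    Tendsto (fun k => corner T (V k)) atTop (𝓝 (corner T (⨆ k, V k).topologicalClosure)) := by
  set P : ℕ → H →L[ℂ] H := fun k => (V k).starProjection
  set P' : H →L[ℂ] H := (⨆ k, V k).topologicalClosure.starProjection
  have hP : ∀ k, ‖P k‖ ≤ 1 := fun k => (V k).starProjection_norm_le
  have hP' : ‖P'‖ ≤ 1 := Submodule.starProjection_norm_le _
  have hlim : ∀ x, Tendsto (fun k => P k x) atTop (𝓝 (P' x)) :=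
    fun x => Submodule.starProjection_tendsto_closure_iSup V hV x
  have h1 : Tendsto (fun k => P k ∘L T) atTop (𝓝 (P' ∘L T)) :=
    hc.tendsto_comp_of_tendsto_apply hP hP' hlim
  have hadj : ∀ Q : H →L[ℂ] H, IsSelfAdjoint Q →
      ContinuousLinearMap.adjoint (Q ∘L T) = T ∘L Q := fun Q hQ => by
    rw [ContinuousLinearMap.adjoint_comp, hs.isSelfAdjoint.adjoint_eq, hQ.adjoint_eq]
  have h2 : Tendsto (fun k => T ∘L P k) atTop (𝓝 (T ∘L P')) := by
    have := ((ContinuousLinearMap.adjoint (𝕜 := ℂ) (E := H) (F := H)).continuous.tendsto _).comp h1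
    rw [hadj _ (isSelfAdjoint_starProjection _)] at this
    refine this.congr fun k => ?_
    exact hadj _ (isSelfAdjoint_starProjection _)
  have h3 : Tendsto (fun k => P k ∘L (T ∘L P k - T ∘L P')) atTop (𝓝 0) := by
    have h0 := tendsto_iff_norm_sub_tendsto_zero.1 h2
    refine squeeze_zero_norm (fun k => ?_) h0
    calc ‖P k ∘L (T ∘L P k - T ∘L P')‖ ≤ ‖P k‖ * ‖T ∘L P k - T ∘L P'‖ :=
          ContinuousLinearMap.opNorm_comp_le _ _
      _ ≤ 1 * ‖T ∘L P k - T ∘L P'‖ := by gcongr; exact hP k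
      _ = _ := one_mul _
  have h4 : Tendsto (fun k => P k ∘L (T ∘L P')) atTop (𝓝 (P' ∘L (T ∘L P'))) :=
    (hc.comp_clm P').tendsto_comp_of_tendsto_apply (T := T ∘L P') hP hP' hlim
  have h5 := h3.add h4
  rw [zero_add] at h5
  refine h5.congr fun k => ?_
  rw [← ContinuousLinearMap.comp_add, sub_add_cancel]
  rfl

end Projections

/-! ### Eigenvalue bounds for compressions -/

section Compressions

theorem inner_compression (T : Ell2 →L[ℂ] Ell2) (V : Submodule ℂ Ell2)
    [V.HasOrthogonalProjection] (x y : V) :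
    ⟪compression T V x, y⟫_ℂ = ⟪T x, (y : Ell2)⟫_ℂ :=
  V.inner_orthogonalProjectionOnto_eq_of_mem_right y (T x)

theorem isSymmetric_compression {T : Ell2 →L[ℂ] Ell2} (hs : T.IsSymmetric)
    (V : Submodule ℂ Ell2) [V.HasOrthogonalProjection] : (compression T V).IsSymmetric := by
  intro x y
  have h1 : ⟪T x, (y : Ell2)⟫_ℂ = ⟪(x : Ell2), T y⟫_ℂ := hs x y
  have h2 : ⟪(x : Ell2), T y⟫_ℂ = ⟪x, compression T V y⟫_ℂ := by
    rw [← inner_conj_symm, ← inner_compression]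
    exact inner_conj_symm (𝕜 := ℂ) x (compression T V y)
  exact (inner_compression T V x y).trans (h1.trans h2)

theorem isCompactOperator_compression {T : Ell2 →L[ℂ] Ell2} (hc : IsCompactOperator T)
    (V : Submodule ℂ Ell2) [V.HasOrthogonalProjection] : IsCompactOperator (compression T V) :=
  (hc.comp_clm V.subtypeL).clm_comp V.orthogonalProjectionOnto

theorem reApplyInnerSelf_compression (T : Ell2 →L[ℂ] Ell2) (V : Submodule ℂ Ell2)
    [V.HasOrthogonalProjection] (x : V) :
    (compression T V).reApplyInnerSelf x = T.reApplyInnerSelf (x : Ell2) :=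
  congrArg RCLike.re (inner_compression T V x x)

theorem formLowerBound_compression {T : Ell2 →L[ℂ] Ell2} {c : ℝ} {n : ℕ}
    {W V : Submodule ℂ Ell2} [V.HasOrthogonalProjection] [FiniteDimensional ℂ W]
    (hn : n ≤ Module.finrank ℂ W) (hWV : W ≤ V)
    (h : ∀ x ∈ W, c * ‖x‖ ^ 2 ≤ T.reApplyInnerSelf x) :
    FormLowerBound (compression T V) c n := by
  let e := Submodule.comapSubtypeEquivOfLe hWV
  refine ⟨W.comap V.subtype, e.symm.finiteDimensional, by rwa [e.finrank_eq], fun x hx => ?_⟩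
  rw [reApplyInnerSelf_compression]
  exact h x hx

/-- For `x` in `V`, orthogonality to the projection of `W` is orthogonality to `W`, and projecting
does not raise the dimension. -/
theorem FormUpperBound.compression {T : Ell2 →L[ℂ] Ell2} {c : ℝ} {n : ℕ}
    (h : FormUpperBound T c n) (V : Submodule ℂ Ell2) [V.HasOrthogonalProjection] :
    FormUpperBound (compression T V) c n := by
  obtain ⟨W, hW, hn, hc⟩ := h
  refine ⟨W.map V.orthogonalProjectionOnto.toLinearMap, inferInstance,
    (Submodule.finrank_map_le _ _).trans_lt hn, fun x hx => ?_⟩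
  rw [reApplyInnerSelf_compression]
  refine hc x ((Submodule.mem_orthogonal' _ _).2 fun w hw => ?_)
  rw [← inner_conj_symm, ← V.inner_orthogonalProjectionOnto_eq_of_mem_right x w, inner_conj_symm]
  exact Submodule.inner_left_of_mem_orthogonal (Submodule.mem_map_of_mem hw) hx

/-- The range of the corner lies in `V`, hence so do its eigenvectors for nonzero eigenvalues. -/
theorem hasEigenvalue_compression_of_corner {T : Ell2 →L[ℂ] Ell2} {V : Submodule ℂ Ell2}
    [V.HasOrthogonalProjection] {ν : ℂ} (hν : ν ≠ 0)
    (h : Module.End.HasEigenvalue (corner T V : Ell2 →ₗ[ℂ] Ell2) ν) :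
    Module.End.HasEigenvalue (compression T V : V →ₗ[ℂ] V) ν := by
  obtain ⟨x, hx⟩ := h.exists_hasEigenvector
  have hTx : V.starProjection (T (V.starProjection x)) = ν • x := hx.apply_eq_smul
  have hxV : x ∈ V := by
    rw [← inv_smul_smul₀ hν x, ← hTx]
    exact V.smul_mem _ (V.starProjection_apply_mem _)
  rw [Submodule.starProjection_eq_self_iff.2 hxV] at hTx
  exact Module.End.hasEigenvalue_of_hasEigenvector (x := ⟨x, hxV⟩)
    (Module.End.hasEigenvector_iff.2 ⟨Module.End.mem_eigenspace_iff.2 (Subtype.ext hTx),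
      fun h0 => hx.2 (congrArg Subtype.val h0)⟩)

end Compressions

/-! ### Eigenvalue bounds for corners -/

section Corners

variable {H : Type*} [NormedAddCommGroup H] [InnerProductSpace ℂ H] {T : H →L[ℂ] H}

theorem reApplyInnerSelf_corner (T : H →L[ℂ] H) (V : Submodule ℂ H) [V.HasOrthogonalProjection]
    (x : H) : (corner T V).reApplyInnerSelf x = T.reApplyInnerSelf (V.starProjection x) :=
  congrArg RCLike.re (inner_corner T V x x)

theorem formLowerBound_corner {c : ℝ} {n : ℕ} {W V : Submodule ℂ H} [V.HasOrthogonalProjection]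
    [FiniteDimensional ℂ W] (hn : n ≤ Module.finrank ℂ W) (hWV : W ≤ V)
    (h : ∀ x ∈ W, c * ‖x‖ ^ 2 ≤ T.reApplyInnerSelf x) : FormLowerBound (corner T V) c n := by
  refine ⟨W, inferInstance, hn, fun x hx => ?_⟩
  rw [reApplyInnerSelf_corner, Submodule.starProjection_eq_self_iff.2 (hWV hx)]
  exact h x hx

/-- The sign of `c` matters because the projection shortens vectors: `c * ‖P x‖ ^ 2 ≤ c * ‖x‖ ^ 2`.
-/
theorem FormUpperBound.corner {c : ℝ} (hc0 : 0 ≤ c) {n : ℕ} (h : FormUpperBound T c n)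
    (V : Submodule ℂ H) [V.HasOrthogonalProjection] : FormUpperBound (corner T V) c n := by
  obtain ⟨W, hW, hn, hc⟩ := h
  refine ⟨W.map V.starProjection.toLinearMap, inferInstance,
    (Submodule.finrank_map_le _ _).trans_lt hn, fun x hx => ?_⟩
  rw [reApplyInnerSelf_corner]
  refine (hc _ ((Submodule.mem_orthogonal' _ _).2 fun w hw => ?_)).trans ?_
  · rw [V.inner_starProjection_left_eq_right]
    exact Submodule.inner_left_of_mem_orthogonal (Submodule.mem_map_of_mem hw) hx
  · gcongr
    exact V.norm_starProjection_apply_le x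

end Corners

/-! ### Uniform bounds on third derivatives -/

section UniformBounds

variable {X E ι : Type*} [NormedAddCommGroup X] [NormedSpace ℝ X] [NormedAddCommGroup E]
  [NormedSpace ℂ E] [Fintype ι]

theorem ContinuousLinearMap.iteratedFDeriv_comp_right_of_contDiffAt {X Y Z : Type*}
    [NormedAddCommGroup X] [NormedSpace ℝ X] [NormedAddCommGroup Y] [NormedSpace ℝ Y]
    [NormedAddCommGroup Z] [NormedSpace ℝ Z] (L : X →L[ℝ] Y) {g : Y → Z} {x : X} {n : ℕ∞ω}
    (hn : n ≠ ∞) (hg : ContDiffAt ℝ n g (L x)) {i : ℕ} (hi : i ≤ n) :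
    iteratedFDeriv ℝ i (g ∘ L) x =
      (iteratedFDeriv ℝ i g (L x)).compContinuousLinearMap fun _ => L := by
  let s : Set Y := {p | ContDiffAt ℝ n g p}
  have hs : IsOpen s := isOpen_iff_mem_nhds.2 fun p hp => hp.eventually hn
  have hLs : IsOpen (L ⁻¹' s) := hs.preimage L.continuous
  have hgs : ContDiffOn ℝ n g s := fun p hp => ContDiffAt.contDiffWithinAt hp
  have := L.iteratedFDerivWithin_comp_right hgs hs.uniqueDiffOn hLs.uniqueDiffOn hg hi
  rwa [iteratedFDerivWithin_of_isOpen i hLs hg, iteratedFDerivWithin_of_isOpen i hs hg] at this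

/-- Functions of the form `x ↦ g (x, y k)`, where `g` is of class `C³` and `y k` converges, have
uniformly bounded third derivatives. -/
theorem ContDiffAt.exists_uniform_bound_iteratedFDeriv {Y : Type*} [NormedAddCommGroup Y]
    [NormedSpace ℝ Y] {g : X × Y → ℝ} {x₀ : X} {y₀ : Y} (hg : ContDiffAt ℝ 3 g (x₀, y₀))
    {y : ℕ → Y} (hy : Tendsto y atTop (𝓝 y₀)) {F : ℕ → X → ℝ}
    (hF : ∀ᶠ p in 𝓝 x₀ ×ˢ atTop, F p.2 p.1 = g (p.1, y p.2)) :
    ∃ r > 0, ∃ C : ℝ, ∃ k₀ : ℕ, ∀ k ≥ k₀, ContDiffOn ℝ 3 (F k) (Metric.ball x₀ r) ∧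
      ∀ x ∈ Metric.ball x₀ r, ‖iteratedFDeriv ℝ 3 (F k) x‖ ≤ C := by
  have hcont : ContinuousAt (iteratedFDeriv ℝ 3 g) (x₀, y₀) :=
    hg.continuousAt_iteratedFDeriv le_rfl
  set C := ‖iteratedFDeriv ℝ 3 g (x₀, y₀)‖ + 1
  have hC : ∀ᶠ p in 𝓝 (x₀, y₀), ‖iteratedFDeriv ℝ 3 g p‖ < C :=
    hcont.norm.eventually_lt_const (by simp [C])
  have hlim : Tendsto (fun p : X × ℕ => (p.1, y p.2)) (𝓝 x₀ ×ˢ atTop) (𝓝 (x₀, y₀)) := by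
    rw [nhds_prod_eq]
    exact tendsto_id.prodMap hy
  have hall : ∀ᶠ p : X × ℕ in 𝓝 x₀ ×ˢ atTop, (ContDiffAt ℝ 3 g (p.1, y p.2) ∧
      ‖iteratedFDeriv ℝ 3 g (p.1, y p.2)‖ < C) ∧ F p.2 p.1 = g (p.1, y p.2) :=
    (hlim.eventually ((hg.eventually (by norm_num)).and hC)).and hF
  obtain ⟨pX, hpX, pN, hpN, hp⟩ := eventually_prod_iff.1 hall
  obtain ⟨r, hr, hball⟩ := Metric.eventually_nhds_iff_ball.1 hpX
  obtain ⟨k₀, hk₀⟩ := eventually_atTop.1 hpN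
  refine ⟨r, hr, C, k₀, fun k hk => ?_⟩
  let L : X →L[ℝ] X × Y := .inl ℝ X Y
  -- `F k` is locally a translate of `g` composed with the inclusion `L` of norm at most 1, so its
  -- third derivative is no larger than that of `g`.
  let gk : X × Y → ℝ := fun p => g (p + (0, y k))
  have hgk : ∀ x ∈ Metric.ball x₀ r, ContDiffAt ℝ 3 gk (L x) := fun x hx => by
    have h1 : ContDiffAt ℝ 3 g (L x + (0, y k)) := by
      have := (hp (hball x hx) (hk₀ k hk)).1.1
      simpa [L] using this
    exact h1.comp (L x) (contDiff_id.add contDiff_const).contDiffAt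
  have hFk : ∀ x ∈ Metric.ball x₀ r, F k x = (gk ∘ L) x := fun x hx => by
    simpa [gk, L] using (hp (hball x hx) (hk₀ k hk)).2
  have hLn : ‖L‖ ≤ 1 := ContinuousLinearMap.norm_inl_le_one ℝ X Y
  refine ⟨fun x hx => ?_, fun x hx => ?_⟩
  · exact ((((hgk x hx).comp x L.contDiff.contDiffAt).contDiffWithinAt).congr hFk (hFk x hx))
  · have heq : F k =ᶠ[𝓝 x] gk ∘ L := by
      filter_upwards [Metric.isOpen_ball.mem_nhds hx] with z hz using hFk z hz
    have hcomp : iteratedFDeriv ℝ 3 (gk ∘ L) x =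
        (iteratedFDeriv ℝ 3 gk (L x)).compContinuousLinearMap fun _ => L :=
      L.iteratedFDeriv_comp_right_of_contDiffAt (by norm_num) (hgk x hx) le_rfl
    rw [(heq.iteratedFDeriv ℝ 3).self_of_nhds, hcomp]
    have hshift : iteratedFDeriv ℝ 3 gk (L x) = iteratedFDeriv ℝ 3 g (x, y k) := by
      rw [iteratedFDeriv_comp_add_right]
      simp [L]
    refine (ContinuousMultilinearMap.norm_compContinuousLinearMap_le _ _).trans ?_
    rw [hshift]
    have hprod : ∏ _i : Fin 3, ‖L‖ ≤ 1 := Finset.prod_le_one (fun _ _ => norm_nonneg _) fun _ _ => hLn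
    calc _ ≤ ‖iteratedFDeriv ℝ 3 g (x, y k)‖ * 1 := by gcongr
      _ ≤ C := by rw [mul_one]; exact (hp (hball x hx) (hk₀ k hk)).1.2.le

/-- The operators `B l` are treated as variables, so that the dependence on `k` becomes a convergent
parameter of a fixed function. -/
theorem contDiffAt_re_comp_sum {Λ : E → ℂ} {f : ι → X → ℝ} {x₀ : X} {B : ι → E}
    (hf : ∀ l, ContDiffAt ℝ 3 (f l) x₀) (hΛ : ContDiffAt ℂ 3 Λ (∑ l, (f l x₀ : ℂ) • B l)) :
    ContDiffAt ℝ 3 (fun p : X × (ι → E) => (Λ (∑ l, (f l p.1 : ℂ) • p.2 l)).re) (x₀, B) := by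
  have h1 : ∀ l, ContDiffAt ℝ 3 (fun p : X × (ι → E) => (f l p.1 : ℂ) • p.2 l) (x₀, B) := by
    intro l
    have ha : ContDiffAt ℝ 3 (fun p : X × (ι → E) => f l p.1) (x₀, B) :=
      (hf l).comp (x₀, B) contDiffAt_fst
    have hb : ContDiffAt ℝ 3 (fun p : X × (ι → E) => p.2 l) (x₀, B) := by fun_prop
    simpa only [Complex.coe_smul] using ha.fun_smul hb
  have h2 : ContDiffAt ℝ 3 (fun p : X × (ι → E) => ∑ l, (f l p.1 : ℂ) • p.2 l) (x₀, B) :=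
    ContDiffAt.sum fun l _ => h1 l
  have h3 : ContDiffAt ℝ 3 (fun p : X × (ι → E) => Λ (∑ l, (f l p.1 : ℂ) • p.2 l)) (x₀, B) :=
    ContDiffAt.comp (g := Λ) (x₀, B) (hΛ.restrict_scalars ℝ) h2
  exact Complex.reCLM.contDiff.contDiffAt.comp _ h3

end UniformBounds

/-! ### Uniform isolation along the greedy subspaces -/

section Greedy

variable {d κ J : ℕ}

theorem greedySubspace_mono (s : ℕ → Fin J → Ell2) (t : ℕ → Fin d → Fin d → Fin J → Ell2) :
    Monotone (greedySubspace s t) := by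
  refine monotone_nat_of_le_succ fun k => ?_
  match k with
  | 0 => simp [greedySubspace]
  | k + 1 =>
    rw [greedySubspace]
    exact le_sup_left.trans le_sup_left

theorem span_le_greedySubspace (s : ℕ → Fin J → Ell2) (t : ℕ → Fin d → Fin d → Fin J → Ell2)
    {k : ℕ} (hk : 1 ≤ k) : Submodule.span ℂ (range (s k)) ≤ greedySubspace s t k := by
  match k, hk with
  | 1, _ => rw [greedySubspace]
  | k + 2, _ =>
    rw [greedySubspace]
    exact le_sup_right.trans le_sup_left

theorem isCompactOperator_paramOp {f : Fin κ → EuclideanSpace ℝ (Fin d) → ℝ}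
    {A : Fin κ → Ell2 →L[ℂ] Ell2} (hA : ∀ l, IsCompactOperator (A l))
    (x : EuclideanSpace ℝ (Fin d)) : IsCompactOperator (paramOp f A x) :=
  (compactOperator (RingHom.id ℂ) Ell2 Ell2).sum_mem fun l _ =>
    (compactOperator (RingHom.id ℂ) Ell2 Ell2).smul_mem (f l x : ℂ) (hA l)

theorem isSymmetric_paramOp {f : Fin κ → EuclideanSpace ℝ (Fin d) → ℝ}
    {A : Fin κ → Ell2 →L[ℂ] Ell2} (hA : ∀ l, IsSelfAdjoint (A l))
    (x : EuclideanSpace ℝ (Fin d)) : (paramOp f A x).IsSymmetric := by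
  rw [← ContinuousLinearMap.isSelfAdjoint_iff_isSymmetric, paramOp]
  exact isSelfAdjoint_sum _ fun l _ =>
    (show IsSelfAdjoint (f l x : ℂ) from Complex.conj_ofReal _).smul (hA l)

theorem continuousAt_paramOp {f : Fin κ → EuclideanSpace ℝ (Fin d) → ℝ}
    {A : Fin κ → Ell2 →L[ℂ] Ell2} {x : EuclideanSpace ℝ (Fin d)}
    (hf : ∀ l, ContinuousAt (f l) x) : ContinuousAt (paramOp f A) x := by
  unfold paramOp
  exact tendsto_finsetSum _ fun l _ =>
    ((Complex.continuous_ofReal.continuousAt.comp (hf l)).smul continuousAt_const)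

/-- The quadratic form of an operator is bounded below on the span of leading eigenvectors of a
nearby operator. -/
theorem AreLeadingEigenvectors.exists_isolating_subspaces {n : ℕ} {T T₀ : Ell2 →L[ℂ] Ell2}
    {v : Fin (n + 1) → Ell2} (hv : AreLeadingEigenvectors (T : Ell2 →ₗ[ℂ] Ell2) v)
    (hc : IsCompactOperator T) (hs : T.IsSymmetric) {l δ : ℝ} (hδ : 0 < δ) (hl : 20 * δ ≤ l)
    (h : IsolatesEigenvalue T₀ n (l - 10 * δ) l (l + δ) (l + 10 * δ)) (hT : ‖T₀ - T‖ ≤ δ)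
    {S : Ell2 →L[ℂ] Ell2} (hS : ‖T₀ - S‖ ≤ δ) {V : Submodule ℂ Ell2} [V.HasOrthogonalProjection]
    (hV : Submodule.span ℂ (range v) ≤ V) :
    IsolatesEigenvalue (compression S V) n (l - 9 * δ) (l - 3 * δ) (l + 2 * δ) (l + 7 * δ) ∧
      IsolatesEigenvalue (corner S V) n (l - 9 * δ) (l - 3 * δ) (l + 2 * δ) (l + 7 * δ) := by
  obtain ⟨hli, hv⟩ := hv
  have hTi := h.perturb hT
  have hE₁ := hTi.lower.hasEigenvaluesIn hc hs (by linarith)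
  have hE₂ := hTi.lower_gap.hasEigenvaluesIn hc hs (by linarith)
  have hST : ‖T - S‖ ≤ 2 * δ := by
    have h1 := norm_sub_le_norm_sub_add_norm_sub T T₀ S
    rw [norm_sub_rev T T₀] at h1
    linarith
  have hform : ∀ {c : ℝ} {x : Ell2}, c * ‖x‖ ^ 2 ≤ T.reApplyInnerSelf x →
      (c - 2 * δ) * ‖x‖ ^ 2 ≤ S.reApplyInnerSelf x := fun {c x} hx => by
    have h1 := (abs_le.1 (abs_reApplyInnerSelf_sub_le T S x)).2
    have h2 := mul_le_mul_of_nonneg_right hST (sq_nonneg ‖x‖)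
    linarith
  -- The first `n` eigenvectors have `T`-eigenvalues at least `l + 9 * δ`, the last one at least `l
  -- - δ`. Passing from `T` to `S` costs `2 * δ`, whence `l + 7 * δ` and `l - 3 * δ`.
  let v' : Fin n → Ell2 := v ∘ Fin.castSucc
  have hli' : LinearIndependent ℂ v' := hli.comp _ (Fin.castSucc_injective n)
  have hsub : Submodule.span ℂ (range v') ≤ Submodule.span ℂ (range v) :=
    Submodule.span_mono (range_comp_subset_range _ _)
  have hX : ∀ x ∈ Submodule.span ℂ (range v), (l - 3 * δ) * ‖x‖ ^ 2 ≤ S.reApplyInnerSelf x := by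
    intro x hx
    have h1 : (l - δ) * ‖x‖ ^ 2 ≤ T.reApplyInnerSelf x :=
      hs.le_reApplyInnerSelf_of_mem_span (fun i => hv i)
        (fun i => (hE₁.of_le (by omega)).le_nthEigenvalue (by omega)) hx
    have h2 := hform h1
    linarith
  have hY : ∀ x ∈ Submodule.span ℂ (range v'), (l + 7 * δ) * ‖x‖ ^ 2 ≤ S.reApplyInnerSelf x := by
    intro x hx
    have h1 : (l + 10 * δ - δ) * ‖x‖ ^ 2 ≤ T.reApplyInnerSelf x :=
      hs.le_reApplyInnerSelf_of_mem_span (fun i => hv i.castSucc)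
        (fun i => (hE₂.of_le (by simp)).le_nthEigenvalue (by omega)) hx
    have h2 := hform h1
    linarith
  have : FiniteDimensional ℂ (Submodule.span ℂ (range v)) :=
    FiniteDimensional.span_of_finite ℂ (finite_range v)
  have : FiniteDimensional ℂ (Submodule.span ℂ (range v')) :=
    FiniteDimensional.span_of_finite ℂ (finite_range v')
  have hrank : n + 1 ≤ Module.finrank ℂ (Submodule.span ℂ (range v)) := by
    rw [finrank_span_eq_card hli, Fintype.card_fin]
  have hrank' : n ≤ Module.finrank ℂ (Submodule.span ℂ (range v')) := by
    rw [finrank_span_eq_card hli', Fintype.card_fin]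
  have hU₁ := (h.upper.perturb hS).mono (show l + δ + δ ≤ l + 2 * δ by linarith)
  have hU₂ := (h.upper_gap.perturb hS).mono (show l - 10 * δ + δ ≤ l - 9 * δ by linarith)
  exact ⟨⟨formLowerBound_compression hrank hV hX, formLowerBound_compression hrank' (hsub.trans hV) hY,
      hU₁.compression V, hU₂.compression V⟩,
    ⟨formLowerBound_corner hrank hV hX, formLowerBound_corner hrank' (hsub.trans hV) hY,
      hU₁.corner (by linarith) V, hU₂.corner (by linarith) V⟩⟩

/-- An isolated eigenvalue extends to a smooth function of the operator. -/
theorem IsolatesEigenvalue.exists_contDiffAt {G : Type*} [NormedAddCommGroup G]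
    [InnerProductSpace ℂ G] [CompleteSpace G] {T₀ : G →L[ℂ] G} {n : ℕ} {b c₁ c₂ a : ℝ}
    (h : IsolatesEigenvalue T₀ n b c₁ c₂ a) (hc : IsCompactOperator T₀) (hs : T₀.IsSymmetric)
    (h0 : 0 < c₁) (hb : b < c₁) (ha : c₂ < a) :
    ∃ Λ : (G →L[ℂ] G) → ℂ, ContDiffAt ℂ 3 Λ T₀ ∧
      ∀ᶠ T : G →L[ℂ] G in 𝓝 T₀, T.IsSymmetric →
        (Λ T).re ∈ Ioo (max b 0) a ∧
          Module.End.HasEigenvalue (T : G →ₗ[ℂ] G) ((Λ T).re : ℂ) := by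
  obtain ⟨hE, hm⟩ := h.nthEigenvalue_mem hc hs h0
  set l := nthEigenvalue (T₀ : G →ₗ[ℂ] G) (n + 1)
  have hl0 : 0 < l := h0.trans_le hm.1
  have hla : l < a := hm.2.trans_lt ha
  have hbl : b < l := hb.trans_le hm.1
  obtain ⟨x, hx⟩ := hE.exists_hasEigenvector
  have hTx : T₀ x = (l : ℂ) • x := hx.apply_eq_smul
  set u : G := ((‖x‖⁻¹ : ℝ) : ℂ) • x
  have hu : ‖u‖ = 1 := by
    rw [norm_smul, Complex.norm_real, norm_inv, norm_norm, inv_mul_cancel₀ (norm_ne_zero_iff.2 hx.2)]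
  have hTu : T₀ u = (l : ℂ) • u := by rw [map_smul, hTx, smul_comm]
  have hu0 : u ≠ 0 := by
    rintro h0
    rw [h0, norm_zero] at hu
    exact zero_ne_one hu
  obtain ⟨Λ, hΛ, hΛ₀, hev⟩ := hc.exists_contDiffAt_eigenvalue hs hl0.ne' hu hTu fun y hy huy =>
    h.eq_zero_of_inner_eq_zero hc hs (hl0.trans hla) ⟨hbl, hla⟩ ⟨hbl, hla⟩ hTu hy huy hu0
  refine ⟨Λ, hΛ, ?_⟩
  have hre : ContinuousAt (fun T => (Λ T).re) T₀ :=
    Complex.continuous_re.continuousAt.comp hΛ.continuousAt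
  -- The bound `max b 0` keeps the eigenvalue positive, hence distinct from the eigenvalue 0 that a
  -- corner may have on the complement of `V`.
  have hmem : ∀ᶠ T in 𝓝 T₀, (Λ T).re ∈ Ioo (max b 0) a :=
    hre.eventually (isOpen_Ioo.mem_nhds (by simp [hΛ₀, hl0, hla, hbl]))
  filter_upwards [hev, hmem] with T hT hTm hTs
  refine ⟨hTm, ?_⟩
  rwa [Complex.conj_eq_iff_re.1 (hTs.conj_eigenvalue_eq_self hT)]

end Greedy

/-! ### The main theorem -/

theorem proposition2p9 {d κ J : ℕ} (hJ : 1 ≤ J)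
    (U Ω : Set (EuclideanSpace ℝ (Fin d))) (hU : IsOpen U) (hΩ : IsCompact Ω) (hΩU : Ω ⊆ U)
    (f : Fin κ → EuclideanSpace ℝ (Fin d) → ℝ) (hf : ∀ l, AnalyticOnNhd ℝ (f l) U)
    (A : Fin κ → Ell2 →L[ℂ] Ell2)
    (hAc : ∀ l, IsCompactOperator (A l)) (hAs : ∀ l, IsSelfAdjoint (A l))
    (hpos : ∀ x ∈ Ω, HasEigenvaluesIn (paramOp f A x : Ell2 →ₗ[ℂ] Ell2) J (Set.Ioi 0))
    (w : ℕ → EuclideanSpace ℝ (Fin d)) (s : ℕ → Fin J → Ell2)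
    (t : ℕ → Fin d → Fin d → Fin J → Ell2)
    (hrun : IsExtendedGreedyRun U Ω f A w s t)
    (wstar : EuclideanSpace ℝ (Fin d))
    (hlim : Filter.Tendsto w Filter.atTop (nhds wstar))
    (hint : wstar ∈ interior Ω)
    (hsimple : IsSimpleNthEigenvalue (paramOp f A wstar : Ell2 →ₗ[ℂ] Ell2) J) :
    ∃ r > 0, ∃ C : ℝ, ∃ k₀ : ℕ, 1 ≤ k₀ ∧ Metric.ball wstar r ⊆ Ω ∧
      ∀ k ≥ k₀,
        ContDiffOn ℝ 3 (stepEigFun f A s t k J) (Metric.ball wstar r) ∧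
        ∀ x ∈ Metric.ball wstar r,
          ‖iteratedFDeriv ℝ 3 (stepEigFun f A s t k J) x‖ ≤ C := by
  obtain ⟨n, rfl⟩ : ∃ n, J = n + 1 := ⟨J - 1, by omega⟩
  have hmem : wstar ∈ Ω := interior_subset hint
  have hfa : ∀ l, AnalyticAt ℝ (f l) wstar := fun l => hf l _ (hΩU hmem)
  have hcomp := isCompactOperator_paramOp (f := f) hAc
  have hsymm := isSymmetric_paramOp (f := f) hAs
  obtain ⟨l, δ, hδ, hl, hiso⟩ :=
    hsimple.exists_isolatesEigenvalue (hcomp _) (hsymm _) (hpos _ hmem)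
  have hcont : ContinuousAt (paramOp f A) wstar := continuousAt_paramOp fun l => (hfa l).continuousAt
  have hnear : ∀ᶠ x in 𝓝 wstar, ‖paramOp f A wstar - paramOp f A x‖ ≤ δ := by
    have h0 : ContinuousAt (fun x => ‖paramOp f A wstar - paramOp f A x‖) wstar :=
      (continuousAt_const.sub hcont).norm
    exact h0.eventually_le_const (by simpa using hδ)
  -- A single iterate close to `wstar` suffices: its leading eigenvectors lie in every later
  -- subspace and in the limit space `W`.
  obtain ⟨k₁, hk₁, hk₁near⟩ := ((eventually_ge_atTop 1).and (hlim.eventually hnear)).exists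
  set V := greedySubspace s t
  have hVm : Monotone V := greedySubspace_mono s t
  have hbounds : ∀ (x : EuclideanSpace ℝ (Fin d)), ‖paramOp f A wstar - paramOp f A x‖ ≤ δ →
      ∀ (V' : Submodule ℂ Ell2) [V'.HasOrthogonalProjection], V k₁ ≤ V' →
      IsolatesEigenvalue (compression (paramOp f A x) V') n
          (l - 9 * δ) (l - 3 * δ) (l + 2 * δ) (l + 7 * δ) ∧
        IsolatesEigenvalue (corner (paramOp f A x) V') n
          (l - 9 * δ) (l - 3 * δ) (l + 2 * δ) (l + 7 * δ) :=
    fun x hx V' _ hV' => (hrun.eigenvectors k₁ hk₁).exists_isolating_subspaces (hcomp _) (hsymm _)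
      hδ hl hiso hk₁near hx ((span_le_greedySubspace s t hk₁).trans hV')
  set W := (⨆ k, V k).topologicalClosure
  have hW : V k₁ ≤ W := (le_iSup V k₁).trans (Submodule.le_topologicalClosure _)
  obtain ⟨Λ, hΛ, hΛev⟩ := (hbounds wstar (by simpa using hδ.le) W hW).2.exists_contDiffAt
    (isCompactOperator_corner (hcomp _) W) (isSymmetric_corner (hsymm _) W) (by linarith)
    (by linarith) (by linarith)
  let B : ℕ → Fin κ → Ell2 →L[ℂ] Ell2 := fun k i => corner (A i) (V k)
  let B' : Fin κ → Ell2 →L[ℂ] Ell2 := fun i => corner (A i) W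
  have hB : Tendsto B atTop (𝓝 B') := tendsto_pi_nhds.2 fun i =>
    tendsto_corner (hAc i) (ContinuousLinearMap.isSelfAdjoint_iff_isSymmetric.1 (hAs i)) hVm
  have hΛ' : ContDiffAt ℂ 3 Λ (∑ i, (f i wstar : ℂ) • B' i) := by
    have h := corner_sum Finset.univ (fun i => (f i wstar : ℂ)) A W
    rw [← h]
    exact hΛ
  have hg := contDiffAt_re_comp_sum (fun i => (hfa i).contDiffAt) hΛ'
  have hsum : Tendsto (fun p : EuclideanSpace ℝ (Fin d) × ℕ => corner (paramOp f A p.1) (V p.2))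
      (𝓝 wstar ×ˢ atTop) (𝓝 (corner (paramOp f A wstar) W)) := by
    simp only [paramOp, corner_sum]
    refine tendsto_finsetSum _ fun i _ => Tendsto.smul ?_ ?_
    · exact (Complex.continuous_ofReal.continuousAt.comp (hfa i).continuousAt).tendsto.comp
        tendsto_fst
    · exact ((tendsto_pi_nhds.1 hB) i).comp tendsto_snd
  -- The identity holds jointly for `x` near `wstar` and large `k`, so the ball does not depend on
  -- `k`.
  have hF : ∀ᶠ p : EuclideanSpace ℝ (Fin d) × ℕ in 𝓝 wstar ×ˢ atTop,
      stepEigFun f A s t p.2 (n + 1) p.1 = (Λ (∑ i, (f i p.1 : ℂ) • B p.2 i)).re := by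
    filter_upwards [hsum.eventually hΛev, tendsto_fst.eventually hnear,
      tendsto_snd.eventually (eventually_ge_atTop k₁)] with p hp hpnear hpk
    obtain ⟨hIoo, hE⟩ := hp (isSymmetric_corner (hsymm _) _)
    have hsumeq : ∑ i, (f i p.1 : ℂ) • B p.2 i = corner (paramOp f A p.1) (V p.2) :=
      (corner_sum Finset.univ (fun i => (f i p.1 : ℂ)) A (V p.2)).symm
    rw [hsumeq]
    have hpos' : (0 : ℝ) < (Λ (corner (paramOp f A p.1) (V p.2))).re :=
      (le_max_right _ _).trans_lt hIoo.1
    -- The real part of `Λ` is a positive eigenvalue of the corner, hence one of the compression,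
    -- and the window contains only the `n + 1`-st.
    refine (hbounds p.1 hpnear (V p.2) (hVm hpk)).1.eq_nthEigenvalue
      (isCompactOperator_compression (hcomp _) _) (isSymmetric_compression (hsymm _) _)
      (by linarith) (by linarith) (by linarith) ⟨(le_max_left _ _).trans_lt hIoo.1, hIoo.2⟩
      (hasEigenvalue_compression_of_corner (by exact_mod_cast hpos'.ne') hE)
  obtain ⟨r, hr, C, k₀, hk₀⟩ := hg.exists_uniform_bound_iteratedFDeriv hB
    (F := fun k => stepEigFun f A s t k (n + 1)) hF
  obtain ⟨ρ, hρ, hρΩ⟩ := Metric.mem_nhds_iff.1 (mem_interior_iff_mem_nhds.1 hint)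
  have hball : Metric.ball wstar (min r ρ) ⊆ Metric.ball wstar r :=
    Metric.ball_subset_ball (min_le_left _ _)
  exact ⟨min r ρ, lt_min hr hρ, C, max k₀ 1, le_max_right _ _,
    (Metric.ball_subset_ball (min_le_right _ _)).trans hρΩ, fun k hk =>
    ⟨(hk₀ k ((le_max_left _ _).trans hk)).1.mono hball,
      fun x hx => (hk₀ k ((le_max_left _ _).trans hk)).2 x (hball hx)⟩⟩
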